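/- **ANN calculus.** Let $\mathbb N=\{1,2,\dots\}$. An ANN is a tuple $\Phi=((W_1,B_1),\dots,(W_L,B_L))$ with $L\in\mathbb N$, $l_0,\dots,l_L\in\mathbb N$, $W_k\in\mathbb R^{l_k\times l_{k-1}}$, $B_k\in\mathbb R^{l_k}$. Let $\mathbf N$ be the set of all ANNs and write $\mathcal L(\Phi)=L$, $\mathcal I(\Phi)=l_0$, $\mathcal O(\Phi)=l_L$, $\mathcal D(\Phi)=(l_0,\dots,l_L)$, $|||\mathcal D(\Phi)|||=\max_k l_k$, $\mathcal P(\Phi)=\sum_{k=1}^L l_k(l_{k-1}+1)$. For $a\colon\mathbb R\to\mathbb R$ the realization $\mathcal R_a(\Phi)\colon\mathbb R^{l_0}\to\mathbb R^{l_L}$ maps $x_0$ to $x_L$, where $x_k=a(W_kx_{k-1}+B_k)$ (componentwise) for $1\le k<L$ and $x_L=W_Lx_{L-1}+B_L$. * $\mathbf A_{W,B}=(W,B)$ is the one-layer ANN. If $\mathcal I(\Phi)=\mathcal O(\Psi)$, the composition $\Phi\bullet\Psi$ is the ANN of length $\mathcal L(\Phi)+\mathcal L(\Psi)-1$ that consists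 of the layers $1,\dots,\mathcal L(\Psi)-1$ of $\Psi$, then the layer $(W_1^\Phi W^\Psi_{\mathcal L(\Psi)},\,W_1^\Phi B^\Psi_{\mathcal L(\Psi)}+B_1^\Phi)$, then the layers $2,\dots,\mathcal L(\Phi)$ of $\Phi$. Moreover, $\lambda\circledast\Phi=\mathbf A_{\lambda I,0}\bullet\Phi$, $\Psi^{\bullet0}=\mathbf A_{I,0}$, $\Psi^{\bullet (n+1)}=\Psi\bullet\Psi^{\bullet n}$, and $\mathcal E_{L,\Psi}(\Phi)=\Psi^{\bullet(L-\mathcal L(\Phi))}\bullet\Phi$ for $\mathcal L(\Phi)\le L$. * For ANNs of equal length, $\mathbf P_n(\Phi_1,\dots,\Phi_n)$ is the ANN of that length whose weight matrices are block diagonal with blocks $W_k^{\Phi_1},\dots,W_k^{\Phi_n}$ and whose biases are stacked; with $L=\max_k\mathcal L(\Phi_k)$ put $\mathrm P_{n,\Psi}(\Phi_1,\dots,\Phi_n)=\mathbf P_n(\mathcal E_{L,\Psi}(\Phi_1),\dots,\mathcal E_{L,\Psi}(\Phi_n))$. * For ANNs of equal length, input dimension $i$ and output dimension $o$, $\bigoplus_{k=u}^v\Phi_k=\mathbf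 A_{(I_o\,\cdots\,I_o),0}\bullet\mathbf P_{v-u+1}(\Phi_u,\dots,\Phi_v)\bullet\mathbf A_{(I_i\,\cdots\,I_i)^{*},0}$; for possibly different lengths, $\boxplus_{k=u,\Psi}^v\Phi_k=\bigoplus_{k=u}^v\mathcal E_{\max_j\mathcal L(\Phi_j),\Psi}(\Phi_k)$, also written $\Phi_u\boxplus_\Psi\cdots\boxplus_\Psi\Phi_v$. For $\mathfrak t_0<\dots<\mathfrak t_K$ let $\mathscr L^{f_0,\dots,f_K}_{\mathfrak t_0,\dots,\mathfrak t_K}\colon\mathbb R\to\mathbb R$ be the function equal to $f_0$ on $(-\infty,\mathfrak t_0)$, to $f_K$ on $[\mathfrak t_K,\infty)$ and to $f_{k-1}+\frac{y-\mathfrak t_{k-1}}{\mathfrak t_k-\mathfrak t_{k-1}}(f_k-f_{k-1})$ at $y\in[\mathfrak t_{k-1},\mathfrak t_k)$. **Corollary 4.11.** Let $K,d,\mathfrak d,M\in\mathbb N$, $T\in(0,\infty)$, $q\in(2,\infty)$, $\mathfrak t_{-1}<0=\mathfrak t_0<\mathfrak t_1<\dots<\mathfrak t_K=T<\mathfrak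 t_{K+1}$, let $a\in C(\mathbb R,\mathbb R)$, and let $\mathfrak J,\mathbf F,\mathbf G\in\mathbf N$ satisfy $\mathcal D(\mathfrak J)=(1,\mathfrak d,1)$, $\mathcal R_a(\mathfrak J)=\mathrm{id}_{\mathbb R}$, $\mathcal R_a(\mathbf F)\in C(\mathbb R,\mathbb R)$, $\mathcal R_a(\mathbf G)\in C(\mathbb R^d,\mathbb R)$. For all $k\in\{0,\dots,K\}$, $\gamma\in(0,1]$ let $\mathbf H_{k,\gamma},\Gamma_\gamma\in\mathbf N$ satisfy $\mathcal R_a(\mathbf H_{k,\gamma})\in C(\mathbb R,\mathbb R)$, $\mathcal R_a(\Gamma_\gamma)\in C(\mathbb R^2,\mathbb R)$ and, for all $t,v,w\in\mathbb R$, $$\bigl|\mathscr L^{0,1,0}_{\mathfrak t_{k-1},\mathfrak t_k,\mathfrak t_{k+1}}(t)-(\mathcal R_a(\mathbf H_{k,\gamma}))(t)\bigr|\le\gamma\max\{1,|t|^q\},\qquad |vw-(\mathcal R_a(\Gamma_\gamma))(v,w)|\le\gamma\max\{1,|v|^q,|w|^q\}.$$ Let $\Theta=\bigcup_{n\in\mathbb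 N}\mathbb Z^n$, for every $\theta\in\Theta$ let $\mathcal U^\theta\colon[0,T]\to[0,T]$ and $W^\theta\colon\mathbb R\to\mathbb R^d$ be functions, and let $U_n^\theta\colon[0,T]\times\mathbb R^d\to\mathbb R$, $n\in\mathbb N_0$, $\theta\in\Theta$, satisfy $U_0^\theta=0$ and, for all $n\in\mathbb N$, $\theta\in\Theta$, $t\in[0,T]$, $x\in\mathbb R^d$, with $f=\mathcal R_a(\mathbf F)$ and $g=\mathcal R_a(\mathbf G)$, $$U_n^\theta(t,x)=\frac1{M^n}\sum_{k=1}^{M^n}g\bigl(x+W^{(\theta,0,-k)}_{T-t}\bigr)+\sum_{i=0}^{n-1}\frac{T-t}{M^{n-i}}\sum_{k=1}^{M^{n-i}}\Bigl(f\circ U_i^{(\theta,i,k)}-\mathbb 1_{\mathbb N}(i)\,f\circ U_{\max\{i-1,0\}}^{(\theta,-i,k)}\Bigr)\bigl(\mathcal U_t^{(\theta,i,k)},\,x+W^{(\theta,i,k)}_{\mathcal U_t^{(\theta,i,k)}-t}\bigr).$$ Let $\mathbf U_{n,t}^\theta\in\mathbf N$, $\theta\in\Theta$, $n\in\mathbb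 N_0$, $t\in[0,T]$, with $\mathcal R_a(\mathbf U_{n,t}^\theta)\in C(\mathbb R^d,\mathbb R)$, satisfy $\mathbf U_{0,t}^\theta=((0\ \cdots\ 0),0)\in\mathbb R^{1\times d}\times\mathbb R^1$ and, for all $n\in\mathbb N$, $$\begin{aligned}\mathbf U_{n,t}^\theta={}&\Bigl[\bigoplus_{k=1}^{M^n}\Bigl(\tfrac1{M^n}\circledast\bigl(\mathbf G\bullet\mathbf A_{I_d,W^{(\theta,0,-k)}_{T-t}}\bigr)\Bigr)\Bigr]\\ &\boxplus_{\mathfrak J}\Bigl[\boxplus_{i=0,\mathfrak J}^{n-1}\Bigl(\tfrac{T-t}{M^{n-i}}\circledast\boxplus_{k=1,\mathfrak J}^{M^{n-i}}\bigl((\mathbf F\bullet\mathbf U^{(\theta,i,k)}_{i,\mathcal U_t^{(\theta,i,k)}})\bullet\mathbf A_{I_d,W^{(\theta,i,k)}_{\mathcal U_t^{(\theta,i,k)}-t}}\bigr)\Bigr)\Bigr]\\ &\boxplus_{\mathfrak J}\Bigl[\boxplus_{i=0,\mathfrak J}^{n-1}\Bigl(\tfrac{(t-T)\mathbb 1_{\mathbb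 N}(i)}{M^{n-i}}\circledast\boxplus_{k=1,\mathfrak J}^{M^{n-i}}\bigl((\mathbf F\bullet\mathbf U^{(\theta,-i,k)}_{\max\{i-1,0\},\mathcal U_t^{(\theta,i,k)}})\bullet\mathbf A_{I_d,W^{(\theta,i,k)}_{\mathcal U_t^{(\theta,i,k)}-t}}\bigr)\Bigr)\Bigr].\end{aligned}$$ Finally, for all $\theta\in\Theta$, $\gamma\in(0,1]$, $n\in\mathbb N$ let $\Phi_{\gamma,n}^\theta=\boxplus_{k=0,\mathfrak J}^K\bigl(\Gamma_\gamma\bullet\mathrm P_{2,\mathfrak J}(\mathbf H_{k,\gamma},\mathbf U_{n,\mathfrak t_k}^\theta)\bigr)$. Then for all $\theta\in\Theta$, $\gamma\in(0,1]$, $n\in\mathbb N$: (i) $\mathcal R_a(\Phi_{\gamma,n}^\theta)\in C(\mathbb R^{d+1},\mathbb R)$ and, for all $t\in\mathbb R$, $x\in\mathbb R^d$, $$(\mathcal R_a(\Phi_{\gamma,n}^\theta))(t,x)=\sum_{k=0}^K(\mathcal R_a(\Gamma_\gamma))\bigl((\mathcal R_a(\mathbf H_{k,\gamma}))(t),\,U_n^\theta(\mathfrak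 t_k,x)\bigr);$$ (ii) for all $t\in[0,T]$, $x\in\mathbb R^d$, $$\Bigl|\mathscr L^{U_n^\theta(\mathfrak t_0,x),\dots,U_n^\theta(\mathfrak t_K,x)}_{\mathfrak t_0,\dots,\mathfrak t_K}(t)-(\mathcal R_a(\Phi_{\gamma,n}^\theta))(t,x)\Bigr|\le2\gamma\bigl(1+(T+1)^q\bigr)^q\sum_{k=0}^K\bigl(1+|U_n^\theta(\mathfrak t_k,x)|^q\bigr);$$ (iii) $$\begin{aligned}\mathcal P(\Phi_{\gamma,n}^\theta)\le{}&16\bigl(\max\{\mathfrak d,\mathcal L(\mathbf G)\}+\mathcal L(\mathbf F)\bigr)\bigl[\max\{\mathfrak d,|||\mathcal D(\mathbf F)|||,|||\mathcal D(\mathbf G)|||\}\bigr]^2\bigl[n^{1/2}(3M)^n\bigr]^2\\&\cdot[\mathcal P(\Gamma_\gamma)]^3\Bigl[\max_{k\in\{0,\dots,K\}}\mathcal P(\mathbf H_{k,\gamma})\Bigr]^3(K+1)^2\,\mathfrak d^2.\end{aligned}$$ -/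

import Mathlib

/-- `ANNLayers h n m` is the type of all tuples `((W₁, B₁), …, (W_L, B_L))` with `L = h + 1` layers,
where `W_k ∈ ℝ^(l_k × l_(k-1))`, `B_k ∈ ℝ^(l_k)`, `l_0 = n`, `l_L = m`, and where the widths
`l_1, …, l_(L-1)` of the `h` hidden layers are arbitrary positive natural numbers. -/
inductive ANNLayers : ℕ → ℕ → ℕ → Type
  | last {n m : ℕ} (W : Matrix (Fin m) (Fin n) ℝ) (B : Fin m → ℝ) : ANNLayers 0 n m
  | cons {h n l m : ℕ} (hl : 0 < l) (W : Matrix (Fin l) (Fin n) ℝ) (B : Fin l → ℝ)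
      (Φ : ANNLayers h l m) : ANNLayers (h + 1) n m

namespace ANNLayers

/-- Number of parameters `∑ k, l_k * (l_(k-1) + 1)`. -/
def params : {h n m : ℕ} → ANNLayers h n m → ℕ
  | _, n, m, .last _ _ => m * (n + 1)
  | _, n, _, .cons (l := l) _ _ _ Φ => l * (n + 1) + Φ.params

/-- The layer dimensions `[l_0, l_1, …, l_L]`. -/
def dims : {h n m : ℕ} → ANNLayers h n m → List ℕ
  | _, n, m, .last _ _ => [n, m]
  | _, n, _, .cons _ _ _ Φ => n :: Φ.dims

/-- The realization with activation `a`: `a` is applied componentwise after every affine map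
except the last one. -/
noncomputable def realize (a : ℝ → ℝ) :
    {h n m : ℕ} → ANNLayers h n m → (Fin n → ℝ) → (Fin m → ℝ)
  | _, _, _, .last W B, x => W.mulVec x + B
  | _, _, _, .cons _ W B Φ, x => Φ.realize a (fun i => a ((W.mulVec x + B) i))

/-- Replace the first affine map `y ↦ W₁ y + B₁` by `x ↦ W₁ (W x + B) + B₁`. -/
noncomputable def precompAffine :
    {h n l m : ℕ} → ANNLayers h l m → Matrix (Fin l) (Fin n) ℝ → (Fin l → ℝ) → ANNLayers h n m
  | _, _, _, _, .last W₁ B₁, W, B => .last (W₁ * W) (W₁.mulVec B + B₁)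
  | _, _, _, _, .cons hl W₁ B₁ Φ, W, B => .cons hl (W₁ * W) (W₁.mulVec B + B₁) Φ

/-- Composition `Φ • Ψ` (first `Ψ`, then `Φ`); the last affine map of `Ψ` and the first
affine map of `Φ` are merged into one layer. -/
noncomputable def comp :
    {h₁ h₂ n l m : ℕ} → ANNLayers h₁ l m → ANNLayers h₂ n l → ANNLayers (h₁ + h₂) n m
  | _, _, _, _, _, Φ, .last W B => Φ.precompAffine W B
  | _, _, _, _, _, Φ, .cons hl W B Ψ => .cons hl W B (Φ.comp Ψ)

/-- The matrix of a one-layer network. -/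
def lastW : {n m : ℕ} → ANNLayers 0 n m → Matrix (Fin m) (Fin n) ℝ
  | _, _, .last W _ => W

/-- The bias of a one-layer network. -/
def lastB : {n m : ℕ} → ANNLayers 0 n m → Fin m → ℝ
  | _, _, .last _ B => B

/-- The width `l_1` of the first hidden layer. -/
def width : {h n m : ℕ} → ANNLayers (h + 1) n m → ℕ
  | _, _, _, .cons (l := l) _ _ _ _ => l

theorem width_pos : ∀ {h n m : ℕ} (Φ : ANNLayers (h + 1) n m), 0 < Φ.width
  | _, _, _, .cons hl _ _ _ => hl

/-- The first matrix of a network with at least one hidden layer. -/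
def firstW : {h n m : ℕ} → (Φ : ANNLayers (h + 1) n m) → Matrix (Fin Φ.width) (Fin n) ℝ
  | _, _, _, .cons _ W _ _ => W

/-- The first bias of a network with at least one hidden layer. -/
def firstB : {h n m : ℕ} → (Φ : ANNLayers (h + 1) n m) → Fin Φ.width → ℝ
  | _, _, _, .cons _ _ B _ => B

/-- All layers but the first one. -/
def tail : {h n m : ℕ} → (Φ : ANNLayers (h + 1) n m) → ANNLayers h Φ.width m
  | _, _, _, .cons _ _ _ Φ => Φ

end ANNLayers

/-- The block diagonal matrix `diag (W_0, …, W_r)`. -/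
def blockDiagFin {r : ℕ} {n m : Fin (r + 1) → ℕ}
    (W : ∀ i, Matrix (Fin (m i)) (Fin (n i)) ℝ) :
    Matrix (Fin (∑ i, m i)) (Fin (∑ i, n i)) ℝ :=
  Matrix.reindex finSigmaFinEquiv finSigmaFinEquiv (Matrix.blockDiagonal' W)

/-- The vector `(B_0, …, B_r)` obtained by stacking. -/
def stackFin {r : ℕ} {m : Fin (r + 1) → ℕ} (B : ∀ i, Fin (m i) → ℝ) : Fin (∑ i, m i) → ℝ :=
  fun p => B (finSigmaFinEquiv.symm p).1 (finSigmaFinEquiv.symm p).2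

/-- The block diagonal matrix `diag (W₁, W₂)`. -/
def blockDiagTwo {n₁ m₁ n₂ m₂ : ℕ} (W₁ : Matrix (Fin m₁) (Fin n₁) ℝ)
    (W₂ : Matrix (Fin m₂) (Fin n₂) ℝ) : Matrix (Fin (m₁ + m₂)) (Fin (n₁ + n₂)) ℝ :=
  Matrix.reindex finSumFinEquiv finSumFinEquiv (Matrix.fromBlocks W₁ 0 0 W₂)

namespace ANNLayers

/-- Parallelization of `r + 1` networks of the same length: in every layer the matrices are
put on the block diagonal and the biases are stacked. -/
def par : {r : ℕ} → (h : ℕ) → {n m : Fin (r + 1) → ℕ} → (∀ i, ANNLayers h (n i) (m i)) →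
    ANNLayers h (∑ i, n i) (∑ i, m i)
  | _, 0, _, _, Φ => .last (blockDiagFin fun i => (Φ i).lastW) (stackFin fun i => (Φ i).lastB)
  | _, h + 1, _, _, Φ =>
      .cons (Finset.sum_pos (fun i _ => (Φ i).width_pos) Finset.univ_nonempty)
        (blockDiagFin fun i => (Φ i).firstW) (stackFin fun i => (Φ i).firstB)
        (par h fun i => (Φ i).tail)

/-- Parallelization of two networks of the same length. -/
def parTwo : {h n₁ m₁ n₂ m₂ : ℕ} → ANNLayers h n₁ m₁ → ANNLayers h n₂ m₂ →
    ANNLayers h (n₁ + n₂) (m₁ + m₂)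
  | _, _, _, _, _, .last W₁ B₁, .last W₂ B₂ => .last (blockDiagTwo W₁ W₂) (Fin.append B₁ B₂)
  | _, _, _, _, _, .cons hl₁ W₁ B₁ Φ₁, .cons _ W₂ B₂ Φ₂ =>
      .cons (Nat.add_pos_left hl₁ _) (blockDiagTwo W₁ W₂) (Fin.append B₁ B₂) (Φ₁.parTwo Φ₂)

end ANNLayers

/-- The ANNs with input dimension `n` and output dimension `m`. -/
structure ANN (n m : ℕ) where
  /-- the number of hidden layers -/
  hidden : ℕ
  /-- the weight matrices and bias vectors -/
  layers : ANNLayers hidden n m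

namespace ANN

variable {n l m : ℕ}

/-- The length (number of affine layers). -/
def length (Φ : ANN n m) : ℕ := Φ.hidden + 1

/-- The number of parameters. -/
def params (Φ : ANN n m) : ℕ := Φ.layers.params

/-- The vector `(l_0, l_1, …, l_L)` of layer dimensions. -/
def dims (Φ : ANN n m) : List ℕ := Φ.layers.dims

/-- The maximum norm of the vector of layer dimensions. -/
def maxDim (Φ : ANN n m) : ℕ := Φ.dims.foldr max 0

/-- The realization function with activation `a`. -/
noncomputable def realize (a : ℝ → ℝ) (Φ : ANN n m) : (Fin n → ℝ) → (Fin m → ℝ) :=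
  Φ.layers.realize a

/-- The realization of a network with output dimension `1`, as a real-valued function. -/
noncomputable def realizeScalar (a : ℝ → ℝ) (Φ : ANN n 1) (x : Fin n → ℝ) : ℝ :=
  Φ.realize a x 0

/-- The affine ANN `(W, B)`. -/
def affine (W : Matrix (Fin m) (Fin n) ℝ) (B : Fin m → ℝ) : ANN n m := ⟨0, .last W B⟩

/-- Composition `Φ • Ψ`: first `Ψ`, then `Φ`. -/
noncomputable def comp (Φ : ANN l m) (Ψ : ANN n l) : ANN n m :=
  ⟨Φ.hidden + Ψ.hidden, Φ.layers.comp Ψ.layers⟩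

/-- Powers: `Ψ^(•0)` is the affine identity ANN and `Ψ^(•(k+1)) = Ψ • Ψ^(•k)`. -/
noncomputable def pow (Ψ : ANN m m) : ℕ → ANN m m
  | 0 => affine 1 0
  | k + 1 => Ψ.comp (Ψ.pow k)

/-- Extension of `Φ` to length `L` by means of `Ψ`: `Ψ^(•(L - length Φ)) • Φ`. It is used for
`length Φ ≤ L`, and has length `L` if `Ψ` has exactly one hidden layer. -/
noncomputable def extend (L : ℕ) (Ψ : ANN m m) (Φ : ANN n m) : ANN n m :=
  (Ψ.pow (L - Φ.length)).comp Φ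

/-- Scalar multiplication `c ⊛ Φ`. -/
noncomputable def scalarMul (c : ℝ) (Φ : ANN n m) : ANN n m :=
  (affine (c • (1 : Matrix (Fin m) (Fin m) ℝ)) 0).comp Φ

open Classical in
/-- Parallelization of `r + 1` ANNs of the same length (a dummy value if the lengths differ). -/
noncomputable def par {r : ℕ} {n m : Fin (r + 1) → ℕ} (Φ : ∀ i, ANN (n i) (m i)) :
    ANN (∑ i, n i) (∑ i, m i) :=
  if h : ∀ i, (Φ i).hidden = (Φ 0).hidden then
    ⟨(Φ 0).hidden, ANNLayers.par (Φ 0).hidden fun i => h i ▸ (Φ i).layers⟩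
  else affine 0 0

/-- Parallelization of two ANNs of the same length (a dummy value if the lengths differ). -/
noncomputable def parTwo {n₁ m₁ n₂ m₂ : ℕ} (Φ₁ : ANN n₁ m₁) (Φ₂ : ANN n₂ m₂) :
    ANN (n₁ + n₂) (m₁ + m₂) :=
  if h : Φ₂.hidden = Φ₁.hidden then
    ⟨Φ₁.hidden, Φ₁.layers.parTwo (h ▸ Φ₂.layers)⟩
  else affine 0 0

/-- Parallelization `P_{2,Ψ}(Φ₁, Φ₂)` of two ANNs of possibly different lengths: both are first
extended by `Ψ` to the larger one of the two lengths. -/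
noncomputable def genParTwo {n₁ n₂ : ℕ} (Ψ : ANN m m) (Φ₁ : ANN n₁ m) (Φ₂ : ANN n₂ m) :
    ANN (n₁ + n₂) (m + m) :=
  (extend (max Φ₁.length Φ₂.length) Ψ Φ₁).parTwo (extend (max Φ₁.length Φ₂.length) Ψ Φ₂)

/-- The summation ANN, with matrix `(I_m I_m … I_m)` (`r + 1` blocks) and bias `0`. -/
def summation (r m : ℕ) : ANN (∑ _i : Fin (r + 1), m) m :=
  affine (Matrix.of fun p q => if p = (finSigmaFinEquiv.symm q).2 then 1 else 0) 0

/-- The vectorization ANN, with matrix `(I_n I_n … I_n)ᵀ` (`r + 1` blocks) and bias `0`. -/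
def vectorization (r n : ℕ) : ANN n (∑ _i : Fin (r + 1), n) :=
  affine (Matrix.of fun p q => if (finSigmaFinEquiv.symm p).2 = q then 1 else 0) 0

/-- The sum `Φ_0 ⊕ … ⊕ Φ_r` of ANNs of the same length. -/
noncomputable def sameSum {r : ℕ} (Φ : Fin (r + 1) → ANN n m) : ANN n m :=
  (summation r m).comp ((par Φ).comp (vectorization r n))

/-- The sum `Φ_0 ⊞_Ψ … ⊞_Ψ Φ_r` of ANNs of possibly different lengths: all summands are first
extended by `Ψ` to the maximal length. -/
noncomputable def boxSum {r : ℕ} (Ψ : ANN m m) (Φ : Fin (r + 1) → ANN n m) : ANN n m :=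
  sameSum fun k => extend (Finset.univ.sup fun j => (Φ j).length) Ψ (Φ k)

/-- `⊕_{k=u}^v Φ_k`, for `u ≤ v`. -/
noncomputable def sameSumFromTo (u v : ℕ) (Φ : ℕ → ANN n m) : ANN n m :=
  sameSum fun k : Fin (v - u + 1) => Φ (u + k)

/-- `⊞_{k=u,Ψ}^v Φ_k`, for `u ≤ v`. -/
noncomputable def boxSumFromTo (Ψ : ANN m m) (u v : ℕ) (Φ : ℕ → ANN n m) : ANN n m :=
  boxSum Ψ fun k : Fin (v - u + 1) => Φ (u + k)

end ANN

/-- For `t_0 < t_1 < … < t_K`: the function equal to `f_0` on `(-∞, t_0)`, to `f_K` on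
`[t_K, ∞)`, and to `f_(k-1) + (x - t_(k-1)) / (t_k - t_(k-1)) * (f_k - f_(k-1))` for
`x ∈ [t_(k-1), t_k)`; exactly one of the conditions below holds for each `x`. -/
noncomputable def linInterp {K : ℕ} (t f : Fin (K + 1) → ℝ) (x : ℝ) : ℝ :=
  (if x < t 0 then f 0 else 0)
    + (∑ k : Fin K, if t k.castSucc ≤ x ∧ x < t k.succ then
        f k.castSucc + (x - t k.castSucc) / (t k.succ - t k.castSucc) * (f k.succ - f k.castSucc)
      else 0)
    + (if t (Fin.last K) ≤ x then f (Fin.last K) else 0)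

/-- `Θ = ⋃_{n ≥ 1} ℤ^n`: the nonempty finite tuples of integers. -/
def MLPIndex : Type := {θ : List ℤ // θ ≠ []}

/-- The index `(θ, i, k)`. -/
def MLPIndex.ext (θ : MLPIndex) (i k : ℤ) : MLPIndex := ⟨θ.1 ++ [i, k], by simp⟩

/-!
The operations of the network calculus act transparently on three quantities: on realizations
(composition, parallelization and summation of networks become composition, juxtaposition and
summation of functions), on the number of layers, and on the widths of the hidden layers. Only
hidden widths are tracked, through the predicate `HiddenLE`: composition merges an output layer
with an input layer, so the hidden widths of `Φ • Ψ` are those of `Ψ` followed by those of `Φ`,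
whereas parallel sums add them up. The network `J` realizes the identity and has one hidden layer,
so extension by `J` adjusts the length without changing the function.

Realization. Since `J` realizes the identity, the recursion of the networks `UU n θ t` realizes
the recursion of the multilevel Picard approximations, and strong induction on `n` identifies the
two (`IsMLPNetwork.realizeScalar_eq`). Summing the approximate products of the hat function networks
with the `UU n θ (τ k)` gives the formula for `Φ θ γ n`.

Error. On `[0, T]` the linear interpolation of grid values is their expansion in hat functions
(`linInterp_eq_sum_hat`). Each hat function is bounded by `1`, so replacing it by `H k γ` and the
product by `Γ γ` costs at most the bound in `abs_mul_sub_le_of_approx` for every grid point.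

Size. Write `c` for the maximum of the widths of `J`, `F` and `G`. By induction the hidden
widths of `UU n θ t` are at most `c * (3 * M) ^ n` (`IsMLPNetwork.hiddenLE`): the level-`i` summands
contribute `M ^ (n - i) * c * (3 * M) ^ i = c * M ^ n * 3 ^ i`, and the three groups of summands
together give a geometric sum of at most `3 ^ n`. The length grows only linearly in `n`
(`IsMLPNetwork.length_le`). A network of length `L` with all dimensions at most `B` has at most
`L * B * (B + 1)` parameters, which yields `params_boxSum_products_le`.
-/

namespace ANNLayers

/-! ### Realizations of layer-wise operations -/

theorem continuous_realize {a : ℝ → ℝ} (ha : Continuous a) :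
    ∀ {h n m : ℕ} (Φ : ANNLayers h n m), Continuous (Φ.realize a)
  | _, _, _, .last W B => by
      simp only [realize]; fun_prop
  | _, _, _, .cons _ W B Φ => by
      simp only [realize]
      exact (continuous_realize ha Φ).comp (by fun_prop)

theorem realize_precompAffine (a : ℝ → ℝ) {h n l m : ℕ} (Φ : ANNLayers h l m)
    (W : Matrix (Fin l) (Fin n) ℝ) (B : Fin l → ℝ) (x : Fin n → ℝ) :
    (Φ.precompAffine W B).realize a x = Φ.realize a (W.mulVec x + B) := by
  cases Φ <;> simp [precompAffine, realize, Matrix.mulVec_add, add_assoc]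

theorem realize_comp (a : ℝ → ℝ) :
    ∀ {h₁ h₂ n l m : ℕ} (Φ : ANNLayers h₁ l m) (Ψ : ANNLayers h₂ n l) (x : Fin n → ℝ),
      (Φ.comp Ψ).realize a x = Φ.realize a (Ψ.realize a x)
  | _, _, _, _, _, Φ, .last W B, x => realize_precompAffine a Φ W B x
  | _, _, _, _, _, Φ, .cons _ _ _ Ψ, _ => realize_comp a Φ Ψ _

theorem realize_zero (a : ℝ → ℝ) {n m : ℕ} (Φ : ANNLayers 0 n m) (x : Fin n → ℝ) :
    Φ.realize a x = Φ.lastW.mulVec x + Φ.lastB := by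
  cases Φ; rfl

theorem realize_succ (a : ℝ → ℝ) {h n m : ℕ} (Φ : ANNLayers (h + 1) n m) (x : Fin n → ℝ) :
    Φ.realize a x = Φ.tail.realize a (fun i => a ((Φ.firstW.mulVec x + Φ.firstB) i)) := by
  cases Φ; rfl

end ANNLayers

/-- The `i`-th block of a stacked vector. -/
def unstackFin {r : ℕ} {n : Fin (r + 1) → ℕ} (x : Fin (∑ i, n i) → ℝ) (i : Fin (r + 1)) :
    Fin (n i) → ℝ :=
  fun j => x (finSigmaFinEquiv ⟨i, j⟩)

theorem stackFin_apply {r : ℕ} {m : Fin (r + 1) → ℕ} (B : ∀ i, Fin (m i) → ℝ) (i : Fin (r + 1))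
    (j : Fin (m i)) : stackFin B (finSigmaFinEquiv ⟨i, j⟩) = B i j := by
  unfold stackFin
  rw [Equiv.symm_apply_apply]

theorem blockDiagFin_mulVec {r : ℕ} {n m : Fin (r + 1) → ℕ}
    (W : ∀ i, Matrix (Fin (m i)) (Fin (n i)) ℝ) (x : Fin (∑ i, n i) → ℝ) :
    (blockDiagFin W).mulVec x = stackFin fun i => (W i).mulVec (unstackFin x i) := by
  funext p
  obtain ⟨⟨i, j⟩, rfl⟩ := finSigmaFinEquiv.surjective p
  rw [stackFin_apply]
  simp only [Matrix.mulVec, dotProduct, blockDiagFin, Matrix.reindex_apply,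
    Matrix.submatrix_apply]
  rw [← finSigmaFinEquiv.sum_comp, Fintype.sum_sigma, Finset.sum_eq_single i]
  · simp only [Equiv.symm_apply_apply, Matrix.blockDiagonal'_apply_eq, unstackFin]
  · intro i' _ hne
    refine Finset.sum_eq_zero fun j' _ => ?_
    simp only [Equiv.symm_apply_apply]
    rw [Matrix.blockDiagonal'_apply_ne _ _ _ hne.symm, zero_mul]
  · simp

theorem blockDiagTwo_mulVec_append {n₁ m₁ n₂ m₂ : ℕ} (W₁ : Matrix (Fin m₁) (Fin n₁) ℝ)
    (W₂ : Matrix (Fin m₂) (Fin n₂) ℝ) (x₁ : Fin n₁ → ℝ) (x₂ : Fin n₂ → ℝ) :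
    (blockDiagTwo W₁ W₂).mulVec (Fin.append x₁ x₂) =
      Fin.append (W₁.mulVec x₁) (W₂.mulVec x₂) := by
  funext p
  obtain ⟨p, rfl⟩ := finSumFinEquiv.surjective p
  simp only [Matrix.mulVec, dotProduct, blockDiagTwo, Matrix.reindex_apply,
    Matrix.submatrix_apply]
  rw [← finSumFinEquiv.sum_comp, Fintype.sum_sum_type]
  cases p <;> simp [Matrix.mulVec, dotProduct]

theorem append_add_append {m₁ m₂ : ℕ} (x₁ y₁ : Fin m₁ → ℝ) (x₂ y₂ : Fin m₂ → ℝ) :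
    Fin.append x₁ x₂ + Fin.append y₁ y₂ = Fin.append (x₁ + y₁) (x₂ + y₂) := by
  funext p
  refine Fin.addCases (fun i => ?_) (fun i => ?_) p <;> simp

namespace ANNLayers

theorem realize_par (a : ℝ → ℝ) {r : ℕ} : ∀ (h : ℕ) {n m : Fin (r + 1) → ℕ}
    (Φ : ∀ i, ANNLayers h (n i) (m i)) (x : Fin (∑ i, n i) → ℝ),
    (par h Φ).realize a x = stackFin fun i => (Φ i).realize a (unstackFin x i)
  | 0, _, _, Φ, x => by
      rw [par, realize, blockDiagFin_mulVec]
      simp only [realize_zero]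
      rfl
  | h + 1, _, _, Φ, x => by
      rw [par, realize, blockDiagFin_mulVec, realize_par a h]
      congr 1
      funext i
      rw [realize_succ a (Φ i)]
      congr 1
      funext j
      simp only [unstackFin, Pi.add_apply, stackFin_apply]

theorem realize_parTwo (a : ℝ → ℝ) : ∀ {h n₁ m₁ n₂ m₂ : ℕ}
    (Φ₁ : ANNLayers h n₁ m₁) (Φ₂ : ANNLayers h n₂ m₂) (x₁ : Fin n₁ → ℝ) (x₂ : Fin n₂ → ℝ),
    (Φ₁.parTwo Φ₂).realize a (Fin.append x₁ x₂) =
      Fin.append (Φ₁.realize a x₁) (Φ₂.realize a x₂)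
  | _, _, _, _, _, .last W₁ B₁, .last W₂ B₂, x₁, x₂ => by
      simp only [parTwo, realize, blockDiagTwo_mulVec_append, append_add_append]
  | _, _, _, _, _, .cons _ W₁ B₁ Φ₁, .cons _ W₂ B₂ Φ₂, x₁, x₂ => by
      simp only [parTwo, realize, blockDiagTwo_mulVec_append, append_add_append]
      rw [← realize_parTwo a Φ₁ Φ₂]
      congr 1
      funext p
      refine Fin.addCases (fun i => ?_) (fun i => ?_) p <;> simp

/-! ### Widths of hidden layers -/

/-- All hidden layers have width at most `b`. The input and the output dimension are not
constrained: composition merges the output layer of one network with the input layer of the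
next one, so only hidden widths behave well under the operations of the calculus. -/
def HiddenLE (b : ℕ) : {h n m : ℕ} → ANNLayers h n m → Prop
  | _, _, _, .last _ _ => True
  | _, _, _, .cons (l := l) _ _ _ Φ => l ≤ b ∧ Φ.HiddenLE b

theorem HiddenLE.mono {b b' : ℕ} (hb : b ≤ b') :
    ∀ {h n m : ℕ} {Φ : ANNLayers h n m}, Φ.HiddenLE b → Φ.HiddenLE b'
  | _, _, _, .last _ _, _ => trivial
  | _, _, _, .cons _ _ _ _, hΦ => ⟨hΦ.1.trans hb, hΦ.2.mono hb⟩

theorem HiddenLE.precompAffine {b h n l m : ℕ} {Φ : ANNLayers h l m} (hΦ : Φ.HiddenLE b)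
    (W : Matrix (Fin l) (Fin n) ℝ) (B : Fin l → ℝ) : (Φ.precompAffine W B).HiddenLE b := by
  cases Φ <;> exact hΦ

theorem HiddenLE.comp {b : ℕ} : ∀ {h₁ h₂ n l m : ℕ} {Φ : ANNLayers h₁ l m}
    {Ψ : ANNLayers h₂ n l}, Φ.HiddenLE b → Ψ.HiddenLE b → (Φ.comp Ψ).HiddenLE b
  | _, _, _, _, _, _, .last W B, hΦ, _ => hΦ.precompAffine W B
  | _, _, _, _, _, _, .cons _ _ _ _, hΦ, hΨ => ⟨hΨ.1, hΦ.comp hΨ.2⟩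

theorem hiddenLE_succ {b h n m : ℕ} (Φ : ANNLayers (h + 1) n m) :
    Φ.HiddenLE b ↔ Φ.width ≤ b ∧ Φ.tail.HiddenLE b := by
  cases Φ; rfl

theorem HiddenLE.par {r : ℕ} {b : Fin (r + 1) → ℕ} : ∀ {h : ℕ} {n m : Fin (r + 1) → ℕ}
    {Φ : ∀ i, ANNLayers h (n i) (m i)}, (∀ i, (Φ i).HiddenLE (b i)) →
      (par h Φ).HiddenLE (∑ i, b i)
  | 0, _, _, _, _ => trivial
  | _ + 1, _, _, _, hΦ =>
      ⟨Finset.sum_le_sum fun i _ => ((hiddenLE_succ _).1 (hΦ i)).1,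
        HiddenLE.par fun i => ((hiddenLE_succ _).1 (hΦ i)).2⟩

theorem HiddenLE.parTwo {b₁ b₂ : ℕ} : ∀ {h n₁ m₁ n₂ m₂ : ℕ}
    {Φ₁ : ANNLayers h n₁ m₁} {Φ₂ : ANNLayers h n₂ m₂},
    Φ₁.HiddenLE b₁ → Φ₂.HiddenLE b₂ → (Φ₁.parTwo Φ₂).HiddenLE (b₁ + b₂)
  | _, _, _, _, _, .last _ _, .last _ _, _, _ => trivial
  | _, _, _, _, _, .cons _ _ _ _, .cons _ _ _ _, h₁, h₂ =>
      ⟨Nat.add_le_add h₁.1 h₂.1, h₁.2.parTwo h₂.2⟩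

theorem params_le_of_hiddenLE {b : ℕ} : ∀ {h n m : ℕ} {Φ : ANNLayers h n m},
    Φ.HiddenLE b → n ≤ b → m ≤ b → Φ.params ≤ (h + 1) * (b * (b + 1))
  | _, n, m, .last _ _, _, hn, hm => by
      simp only [params, zero_add, one_mul]
      gcongr
  | _, n, m, .cons (l := l) _ _ _ Φ, hΦ, hn, hm => by
      have h1 := params_le_of_hiddenLE hΦ.2 hΦ.1 hm
      have h2 : l * (n + 1) ≤ b * (b + 1) := Nat.mul_le_mul hΦ.1 (by omega)
      simp only [params]
      linarith

theorem hiddenLE_params : ∀ {h n m : ℕ} (Φ : ANNLayers h n m), Φ.HiddenLE Φ.params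
  | _, _, _, .last _ _ => trivial
  | _, n, _, .cons (l := l) _ _ _ Φ =>
      ⟨(Nat.le_mul_of_pos_right l (Nat.succ_pos n)).trans (Nat.le_add_right _ _),
        (hiddenLE_params Φ).mono (Nat.le_add_left _ _)⟩

theorem succ_le_params : ∀ {h n m : ℕ} (Φ : ANNLayers h n m), 0 < m → h + 1 ≤ Φ.params
  | _, n, _, .last _ _, hm => Nat.mul_pos hm (Nat.succ_pos n)
  | _, n, _, .cons hl _ _ Φ, hm => by
      have h1 := succ_le_params Φ hm
      have h2 : 0 < _ * (n + 1) := Nat.mul_pos hl (Nat.succ_pos n)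
      simp only [params]
      omega

theorem input_lt_params {h n m : ℕ} (Φ : ANNLayers h n m) (hm : 0 < m) : n < Φ.params := by
  cases Φ with
  | last => exact Nat.le_mul_of_pos_left _ hm
  | cons hl _ _ _ => exact (Nat.le_mul_of_pos_left _ hl).trans (Nat.le_add_right _ _)

theorem length_dims : ∀ {h n m : ℕ} (Φ : ANNLayers h n m), Φ.dims.length = h + 2
  | _, _, _, .last _ _ => rfl
  | _, _, _, .cons _ _ _ Φ => by simp [dims, length_dims Φ]

theorem input_mem_dims {h n m : ℕ} (Φ : ANNLayers h n m) : n ∈ Φ.dims := by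
  cases Φ <;> simp [dims]

theorem hiddenLE_of_dims_le {b : ℕ} : ∀ {h n m : ℕ} (Φ : ANNLayers h n m),
    (∀ k ∈ Φ.dims, k ≤ b) → Φ.HiddenLE b
  | _, _, _, .last _ _, _ => trivial
  | _, _, _, .cons _ _ _ Φ, hΦ =>
      ⟨hΦ _ (List.mem_cons_of_mem _ Φ.input_mem_dims),
        hiddenLE_of_dims_le Φ fun k hk => hΦ k (List.mem_cons_of_mem _ hk)⟩

end ANNLayers

namespace ANN

variable {n l m : ℕ}

/-! ### The calculus of networks of arbitrary length -/

/-- All hidden layers have width at most `b`. -/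
def HiddenLE (b : ℕ) (Φ : ANN n m) : Prop := Φ.layers.HiddenLE b

theorem HiddenLE.mono {b b' : ℕ} {Φ : ANN n m} (h : Φ.HiddenLE b) (hb : b ≤ b') :
    Φ.HiddenLE b' :=
  ANNLayers.HiddenLE.mono hb h

theorem HiddenLE.comp {b : ℕ} {Φ : ANN l m} {Ψ : ANN n l} (hΦ : Φ.HiddenLE b)
    (hΨ : Ψ.HiddenLE b) : (Φ.comp Ψ).HiddenLE b :=
  ANNLayers.HiddenLE.comp hΦ hΨ

theorem hiddenLE_affine {b : ℕ} (W : Matrix (Fin m) (Fin n) ℝ) (B : Fin m → ℝ) :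
    (affine W B).HiddenLE b :=
  trivial

theorem HiddenLE.scalarMul {b : ℕ} {Φ : ANN n m} (hΦ : Φ.HiddenLE b) (c : ℝ) :
    (scalarMul c Φ).HiddenLE b :=
  (hiddenLE_affine _ _).comp hΦ

theorem HiddenLE.pow {b : ℕ} {Ψ : ANN m m} (hΨ : Ψ.HiddenLE b) : ∀ k, (Ψ.pow k).HiddenLE b
  | 0 => hiddenLE_affine _ _
  | k + 1 => hΨ.comp (hΨ.pow k)

theorem HiddenLE.extend {b : ℕ} {Ψ : ANN m m} {Φ : ANN n m} (hΨ : Ψ.HiddenLE b)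
    (hΦ : Φ.HiddenLE b) (L : ℕ) : (extend L Ψ Φ).HiddenLE b :=
  (hΨ.pow _).comp hΦ

theorem le_maxDim {Φ : ANN n m} {k : ℕ} (hk : k ∈ Φ.dims) : k ≤ Φ.maxDim := by
  unfold maxDim
  generalize Φ.dims = ds at hk ⊢
  induction ds with
  | nil => simp at hk
  | cons x xs ih =>
    rcases List.mem_cons.1 hk with rfl | hk
    · exact le_max_left _ _
    · exact (ih hk).trans (le_max_right _ _)

theorem hiddenLE_maxDim (Φ : ANN n m) : Φ.HiddenLE Φ.maxDim :=
  Φ.layers.hiddenLE_of_dims_le fun _ hk => le_maxDim hk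

theorem input_le_maxDim (Φ : ANN n m) : n ≤ Φ.maxDim := le_maxDim Φ.layers.input_mem_dims

theorem hidden_pow {Ψ : ANN m m} (hΨ : Ψ.hidden = 1) : ∀ k, (Ψ.pow k).hidden = k
  | 0 => rfl
  | k + 1 => by
      change Ψ.hidden + (Ψ.pow k).hidden = _
      rw [hidden_pow hΨ k, hΨ, add_comm]

theorem length_pos (Φ : ANN n m) : 0 < Φ.length := Nat.succ_pos _

theorem length_extend {Ψ : ANN m m} (hΨ : Ψ.hidden = 1) {Φ : ANN n m} {L : ℕ}
    (hL : Φ.length ≤ L) : (extend L Ψ Φ).length = L := by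
  change (Ψ.pow (L - Φ.length)).hidden + Φ.hidden + 1 = L
  rw [hidden_pow hΨ]
  have : Φ.length = Φ.hidden + 1 := rfl
  omega

theorem length_scalarMul (c : ℝ) (Φ : ANN n m) : (scalarMul c Φ).length = Φ.length := by
  change 0 + Φ.hidden + 1 = Φ.hidden + 1
  rw [zero_add]

theorem realize_affine (a : ℝ → ℝ) (W : Matrix (Fin m) (Fin n) ℝ) (B : Fin m → ℝ)
    (x : Fin n → ℝ) : (affine W B).realize a x = W.mulVec x + B :=
  rfl

theorem realize_comp (a : ℝ → ℝ) (Φ : ANN l m) (Ψ : ANN n l) (x : Fin n → ℝ) :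
    (Φ.comp Ψ).realize a x = Φ.realize a (Ψ.realize a x) :=
  ANNLayers.realize_comp a _ _ x

theorem realize_scalarMul (a : ℝ → ℝ) (c : ℝ) (Φ : ANN n m) (x : Fin n → ℝ) :
    (scalarMul c Φ).realize a x = c • Φ.realize a x := by
  rw [scalarMul, realize_comp, realize_affine, Matrix.smul_mulVec, Matrix.one_mulVec, add_zero]

theorem realize_pow {a : ℝ → ℝ} {Ψ : ANN m m} (hΨ : ∀ x, Ψ.realize a x = x) (x : Fin m → ℝ) :
    ∀ k, (Ψ.pow k).realize a x = x
  | 0 => by rw [pow, realize_affine, Matrix.one_mulVec, add_zero]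
  | k + 1 => by rw [pow, realize_comp, realize_pow hΨ x k, hΨ]

theorem realize_extend {a : ℝ → ℝ} {Ψ : ANN m m} (hΨ : ∀ x, Ψ.realize a x = x) (L : ℕ)
    (Φ : ANN n m) (x : Fin n → ℝ) : (extend L Ψ Φ).realize a x = Φ.realize a x := by
  rw [extend, realize_comp, realize_pow hΨ]

/-- For networks of equal length the dummy branch of `ANN.par` is not taken. -/
theorem par_mk {r h : ℕ} {n m : Fin (r + 1) → ℕ} (Φ : ∀ i, ANNLayers h (n i) (m i)) :
    par (fun i => (⟨h, Φ i⟩ : ANN (n i) (m i))) = ⟨h, ANNLayers.par h Φ⟩ := by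
  rw [par, dif_pos fun _ => rfl]

/-- Networks of equal length are given by layers in one and the same type `ANNLayers h`, which
removes all casts between different numbers of hidden layers. -/
theorem exists_layers {ι : Type*} {h : ℕ} {n m : ι → ℕ} {Φ : ∀ i, ANN (n i) (m i)}
    (hΦ : ∀ i, (Φ i).length = h + 1) :
    ∃ Λ : ∀ i, ANNLayers h (n i) (m i), Φ = fun i => ⟨h, Λ i⟩ := by
  have (i : ι) : ∃ Λ : ANNLayers h (n i) (m i), Φ i = ⟨h, Λ⟩ := by
    have hi := hΦ i
    generalize Φ i = Ψ at hi ⊢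
    obtain ⟨h', Λ⟩ := Ψ
    obtain rfl : h' = h := Nat.succ_injective hi
    exact ⟨Λ, rfl⟩
  choose Λ hΛ using this
  exact ⟨Λ, funext hΛ⟩

theorem length_sameSum {r : ℕ} {Φ : Fin (r + 1) → ANN n m} {L : ℕ}
    (hΦ : ∀ i, (Φ i).length = L) : (sameSum Φ).length = L := by
  obtain ⟨h, rfl⟩ : ∃ h, L = h + 1 := ⟨_, (hΦ 0).symm⟩
  obtain ⟨Λ, rfl⟩ := exists_layers hΦ
  rw [sameSum, par_mk]
  change 0 + (h + 0) + 1 = h + 1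
  omega

theorem HiddenLE.sameSum {r : ℕ} {Φ : Fin (r + 1) → ANN n m} {L : ℕ}
    (hL : ∀ i, (Φ i).length = L) {b : Fin (r + 1) → ℕ} (hΦ : ∀ i, (Φ i).HiddenLE (b i)) :
    (sameSum Φ).HiddenLE (∑ i, b i) := by
  obtain ⟨h, rfl⟩ : ∃ h, L = h + 1 := ⟨_, (hL 0).symm⟩
  obtain ⟨Λ, rfl⟩ := exists_layers hL
  rw [ANN.sameSum, par_mk]
  exact (hiddenLE_affine _ _).comp
    (HiddenLE.comp (Φ := ⟨h, ANNLayers.par h Λ⟩) (ANNLayers.HiddenLE.par hΦ)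
      (hiddenLE_affine _ _))

theorem realize_summation {r : ℕ} (x : Fin (r + 1) → Fin m → ℝ) (a : ℝ → ℝ) :
    (summation r m).realize a (stackFin x) = ∑ k, x k := by
  rw [summation, realize_affine, add_zero]
  funext p
  simp only [Matrix.mulVec, dotProduct, Matrix.of_apply, Finset.sum_apply, stackFin]
  rw [← finSigmaFinEquiv.sum_comp, Fintype.sum_sigma]
  simp [Equiv.symm_apply_apply]

theorem unstackFin_vectorization (r : ℕ) (a : ℝ → ℝ) (x : Fin n → ℝ) (i : Fin (r + 1)) :
    unstackFin (n := fun _ => n) ((vectorization r n).realize a x) i = x := by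
  rw [vectorization, realize_affine, add_zero]
  funext p
  simp only [unstackFin, Matrix.mulVec, dotProduct, Matrix.of_apply]
  rw [Equiv.symm_apply_apply]
  simp

theorem realize_sameSum (a : ℝ → ℝ) {r : ℕ} {Φ : Fin (r + 1) → ANN n m} {L : ℕ}
    (hΦ : ∀ i, (Φ i).length = L) (x : Fin n → ℝ) :
    (sameSum Φ).realize a x = ∑ k, (Φ k).realize a x := by
  obtain ⟨h, rfl⟩ : ∃ h, L = h + 1 := ⟨_, (hΦ 0).symm⟩
  obtain ⟨Λ, rfl⟩ := exists_layers hΦ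
  rw [sameSum, realize_comp, realize_comp, par_mk]
  change (summation r m).realize a ((ANNLayers.par h Λ).realize a _) = _
  rw [ANNLayers.realize_par, realize_summation]
  refine Finset.sum_congr rfl fun k _ => ?_
  rw [unstackFin_vectorization]
  rfl

section BoxSum

variable {r : ℕ} {Ψ : ANN m m} (Φ : Fin (r + 1) → ANN n m)

theorem length_extend_sup (h : Ψ.hidden = 1) (k : Fin (r + 1)) :
    (extend (Finset.univ.sup fun j => (Φ j).length) Ψ (Φ k)).length =
      Finset.univ.sup fun j => (Φ j).length :=
  length_extend h (Finset.le_sup (f := fun j => (Φ j).length) (Finset.mem_univ k))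

theorem length_boxSum (h : Ψ.hidden = 1) :
    (boxSum Ψ Φ).length = Finset.univ.sup fun j => (Φ j).length :=
  length_sameSum (length_extend_sup Φ h)

theorem length_boxSum_le (h : Ψ.hidden = 1) {L : ℕ} (hL : ∀ k, (Φ k).length ≤ L) :
    (boxSum Ψ Φ).length ≤ L := by
  rw [length_boxSum Φ h]
  exact Finset.sup_le fun k _ => hL k

theorem realize_boxSum {a : ℝ → ℝ} (h : Ψ.hidden = 1) (hΨ : ∀ x, Ψ.realize a x = x)
    (x : Fin n → ℝ) : (boxSum Ψ Φ).realize a x = ∑ k, (Φ k).realize a x := by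
  rw [boxSum, realize_sameSum a (length_extend_sup Φ h)]
  simp only [realize_extend hΨ]

variable {Φ}

theorem HiddenLE.boxSum (h : Ψ.hidden = 1) {c : ℕ} (hΨ : Ψ.HiddenLE c) {b : Fin (r + 1) → ℕ}
    (hb : ∀ k, c ≤ b k) (hΦ : ∀ k, (Φ k).HiddenLE (b k)) :
    (boxSum Ψ Φ).HiddenLE (∑ k, b k) :=
  HiddenLE.sameSum (length_extend_sup Φ h) fun k => (hΨ.mono (hb k)).extend (hΦ k) _

end BoxSum

section FromTo

variable {Ψ : ANN m m} {u v : ℕ} {Φ : ℕ → ANN n m}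

theorem _root_.Fin.sum_add_eq_sum_Icc {E : Type*} [AddCommMonoid E] (huv : u ≤ v) (f : ℕ → E) :
    ∑ k : Fin (v - u + 1), f (u + k) = ∑ k ∈ Finset.Icc u v, f k := by
  rw [Fin.sum_univ_eq_sum_range fun k => f (u + k), ← Finset.Ico_add_one_right_eq_Icc,
    Finset.sum_Ico_eq_sum_range, Nat.sub_add_comm huv]

theorem realize_sameSumFromTo (a : ℝ → ℝ) (huv : u ≤ v) {L : ℕ}
    (hΦ : ∀ k, (Φ k).length = L) (x : Fin n → ℝ) :
    (sameSumFromTo u v Φ).realize a x = ∑ k ∈ Finset.Icc u v, (Φ k).realize a x := by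
  rw [sameSumFromTo, realize_sameSum a fun i => hΦ _,
    Fin.sum_add_eq_sum_Icc huv fun k => (Φ k).realize a x]

theorem realize_boxSumFromTo {a : ℝ → ℝ} (h : Ψ.hidden = 1) (hΨ : ∀ x, Ψ.realize a x = x)
    (huv : u ≤ v) (x : Fin n → ℝ) :
    (boxSumFromTo Ψ u v Φ).realize a x = ∑ k ∈ Finset.Icc u v, (Φ k).realize a x := by
  rw [boxSumFromTo, realize_boxSum _ h hΨ,
    Fin.sum_add_eq_sum_Icc huv fun k => (Φ k).realize a x]

theorem length_boxSumFromTo_le (h : Ψ.hidden = 1) (huv : u ≤ v) {L : ℕ}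
    (hL : ∀ k ∈ Finset.Icc u v, (Φ k).length ≤ L) : (boxSumFromTo Ψ u v Φ).length ≤ L :=
  length_boxSum_le _ h fun k => hL _ (Finset.mem_Icc.2 (by omega))

theorem HiddenLE.sameSumFromTo (huv : u ≤ v) {L : ℕ} (hL : ∀ k, (Φ k).length = L) {b : ℕ → ℕ}
    (hΦ : ∀ k ∈ Finset.Icc u v, (Φ k).HiddenLE (b k)) :
    (sameSumFromTo u v Φ).HiddenLE (∑ k ∈ Finset.Icc u v, b k) := by
  rw [← Fin.sum_add_eq_sum_Icc huv]
  exact HiddenLE.sameSum (fun i => hL _) fun k => hΦ _ (Finset.mem_Icc.2 (by omega))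

theorem HiddenLE.boxSumFromTo (h : Ψ.hidden = 1) (huv : u ≤ v) {c : ℕ} (hΨ : Ψ.HiddenLE c)
    {b : ℕ → ℕ} (hb : ∀ k ∈ Finset.Icc u v, c ≤ b k)
    (hΦ : ∀ k ∈ Finset.Icc u v, (Φ k).HiddenLE (b k)) :
    (boxSumFromTo Ψ u v Φ).HiddenLE (∑ k ∈ Finset.Icc u v, b k) := by
  rw [← Fin.sum_add_eq_sum_Icc huv]
  exact HiddenLE.boxSum h hΨ (fun k => hb _ (Finset.mem_Icc.2 (by omega)))
    fun k => hΦ _ (Finset.mem_Icc.2 (by omega))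

end FromTo

/-! ### Parallelization of two networks -/

section ParTwo

variable {n₁ m₁ n₂ m₂ : ℕ}

theorem parTwo_mk {h : ℕ} (Λ₁ : ANNLayers h n₁ m₁) (Λ₂ : ANNLayers h n₂ m₂) :
    parTwo ⟨h, Λ₁⟩ ⟨h, Λ₂⟩ = ⟨h, Λ₁.parTwo Λ₂⟩ := by
  rw [parTwo, dif_pos rfl]

theorem exists_layers_two {Φ₁ : ANN n₁ m₁} {Φ₂ : ANN n₂ m₂} (h : Φ₁.length = Φ₂.length) :
    ∃ (k : ℕ) (Λ₁ : ANNLayers k n₁ m₁) (Λ₂ : ANNLayers k n₂ m₂),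
      Φ₁ = ⟨k, Λ₁⟩ ∧ Φ₂ = ⟨k, Λ₂⟩ := by
  obtain ⟨k, Λ₁⟩ := Φ₁
  obtain ⟨k', Λ₂⟩ := Φ₂
  obtain rfl : k = k' := Nat.succ_injective h
  exact ⟨k, Λ₁, Λ₂, rfl, rfl⟩

theorem realize_parTwo (a : ℝ → ℝ) {Φ₁ : ANN n₁ m₁} {Φ₂ : ANN n₂ m₂}
    (h : Φ₁.length = Φ₂.length) (x₁ : Fin n₁ → ℝ) (x₂ : Fin n₂ → ℝ) :
    (Φ₁.parTwo Φ₂).realize a (Fin.append x₁ x₂) =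
      Fin.append (Φ₁.realize a x₁) (Φ₂.realize a x₂) := by
  obtain ⟨k, Λ₁, Λ₂, rfl, rfl⟩ := exists_layers_two h
  rw [parTwo_mk]
  exact ANNLayers.realize_parTwo a Λ₁ Λ₂ x₁ x₂

theorem length_parTwo {Φ₁ : ANN n₁ m₁} {Φ₂ : ANN n₂ m₂} (h : Φ₁.length = Φ₂.length) :
    (Φ₁.parTwo Φ₂).length = Φ₁.length := by
  obtain ⟨k, Λ₁, Λ₂, rfl, rfl⟩ := exists_layers_two h
  rw [parTwo_mk]
  rfl

theorem HiddenLE.parTwo {Φ₁ : ANN n₁ m₁} {Φ₂ : ANN n₂ m₂} (h : Φ₁.length = Φ₂.length)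
    {b₁ b₂ : ℕ} (h₁ : Φ₁.HiddenLE b₁) (h₂ : Φ₂.HiddenLE b₂) :
    (Φ₁.parTwo Φ₂).HiddenLE (b₁ + b₂) := by
  obtain ⟨k, Λ₁, Λ₂, rfl, rfl⟩ := exists_layers_two h
  rw [parTwo_mk]
  exact ANNLayers.HiddenLE.parTwo h₁ h₂

variable {Ψ : ANN m m} (Φ₁ : ANN n₁ m) (Φ₂ : ANN n₂ m)

theorem length_extend_max (hΨ : Ψ.hidden = 1) :
    (extend (max Φ₁.length Φ₂.length) Ψ Φ₁).length =
      (extend (max Φ₁.length Φ₂.length) Ψ Φ₂).length := by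
  rw [length_extend hΨ (le_max_left _ _), length_extend hΨ (le_max_right _ _)]

theorem length_genParTwo (hΨ : Ψ.hidden = 1) :
    (genParTwo Ψ Φ₁ Φ₂).length = max Φ₁.length Φ₂.length := by
  rw [genParTwo, length_parTwo (length_extend_max Φ₁ Φ₂ hΨ), length_extend hΨ (le_max_left _ _)]

theorem realize_genParTwo (hΨ : Ψ.hidden = 1) {a : ℝ → ℝ} (hid : ∀ x, Ψ.realize a x = x) (x₁ : Fin n₁ → ℝ)
    (x₂ : Fin n₂ → ℝ) :
    (genParTwo Ψ Φ₁ Φ₂).realize a (Fin.append x₁ x₂) =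
      Fin.append (Φ₁.realize a x₁) (Φ₂.realize a x₂) := by
  rw [genParTwo, realize_parTwo a (length_extend_max Φ₁ Φ₂ hΨ), realize_extend hid,
    realize_extend hid]

variable {Φ₁ Φ₂}

theorem HiddenLE.genParTwo (hΨ : Ψ.hidden = 1) {b₁ b₂ : ℕ} (hΨ₁ : Ψ.HiddenLE b₁) (hΨ₂ : Ψ.HiddenLE b₂)
    (h₁ : Φ₁.HiddenLE b₁) (h₂ : Φ₂.HiddenLE b₂) :
    (genParTwo Ψ Φ₁ Φ₂).HiddenLE (b₁ + b₂) :=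
  HiddenLE.parTwo (length_extend_max Φ₁ Φ₂ hΨ) (hΨ₁.extend h₁ _) (hΨ₂.extend h₂ _)

end ParTwo

end ANN

/-! ### Piecewise linear interpolation and hat functions -/

theorem linInterp_hat (p q r t : ℝ) :
    linInterp ![p, q, r] ![0, 1, 0] t =
      (if p ≤ t ∧ t < q then (t - p) / (q - p) else 0)
        + (if q ≤ t ∧ t < r then 1 - (t - q) / (r - q) else 0) := by
  rw [linInterp, Fin.sum_univ_two]
  change (if t < p then (0 : ℝ) else 0) +
    ((if p ≤ t ∧ t < q then 0 + (t - p) / (q - p) * (1 - 0) else 0) +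
      (if q ≤ t ∧ t < r then 1 + (t - q) / (r - q) * (0 - 1) else 0)) +
    (if r ≤ t then (0 : ℝ) else 0) = _
  simp [sub_eq_add_neg]

theorem abs_linInterp_hat_le {p q r : ℝ} (hpq : p < q) (hqr : q < r) (t : ℝ) :
    |linInterp ![p, q, r] ![0, 1, 0] t| ≤ 1 := by
  rw [linInterp_hat]
  by_cases h1 : p ≤ t ∧ t < q
  · rw [if_pos h1, if_neg fun h => h1.2.not_ge h.1, add_zero, abs_of_nonneg
      (div_nonneg (sub_nonneg.2 h1.1) (sub_pos.2 hpq).le), div_le_one (sub_pos.2 hpq)]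
    linarith [h1.2]
  · rw [if_neg h1, zero_add]
    split_ifs with h2
    · have h3 : 0 ≤ (t - q) / (r - q) := div_nonneg (sub_nonneg.2 h2.1) (sub_pos.2 hqr).le
      have h4 : (t - q) / (r - q) ≤ 1 := (div_le_one (sub_pos.2 hqr)).2 (by linarith [h2.2])
      rw [abs_le]
      constructor <;> linarith
    · simp

/-- On the interval spanned by the grid, linear interpolation is the expansion in hat functions.
Only the two outermost hat functions reach beyond this interval. -/
theorem linInterp_eq_sum_hat (K : ℕ) (τ : ℤ → ℝ) (hlast : τ K < τ (K + 1)) (f : ℕ → ℝ) {t : ℝ}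
    (h0 : τ 0 ≤ t) (hK : t ≤ τ K) :
    linInterp (fun k : Fin (K + 1) => τ ((k : ℕ) : ℤ)) (fun k : Fin (K + 1) => f k) t =
      ∑ k ∈ Finset.range (K + 1),
        linInterp ![τ ((k : ℤ) - 1), τ (k : ℤ), τ ((k : ℤ) + 1)] ![0, 1, 0] t * f k := by
  simp only [linInterp_hat, add_mul, Finset.sum_add_distrib]
  rw [Finset.sum_range_succ', Finset.sum_range_succ (n := K)]
  have hleft : ¬ (τ (((0 : ℕ) : ℤ) - 1) ≤ t ∧ t < τ ((0 : ℕ) : ℤ)) := fun h => h.2.not_ge h0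
  rw [if_neg hleft, zero_mul, add_zero, linInterp]
  have hfirst : ¬ t < τ (((0 : Fin (K + 1)) : ℕ) : ℤ) := h0.not_gt
  rw [if_neg hfirst, zero_add, ← add_assoc, ← Finset.sum_add_distrib]
  congr 1
  · rw [← Fin.sum_univ_eq_sum_range (fun k =>
      (if τ (((k + 1 : ℕ) : ℤ) - 1) ≤ t ∧ t < τ ((k + 1 : ℕ) : ℤ) then
        (t - τ (((k + 1 : ℕ) : ℤ) - 1)) / (τ ((k + 1 : ℕ) : ℤ) - τ (((k + 1 : ℕ) : ℤ) - 1))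
        else 0) * f (k + 1) +
      (if τ (k : ℤ) ≤ t ∧ t < τ ((k : ℤ) + 1) then
        1 - (t - τ (k : ℤ)) / (τ ((k : ℤ) + 1) - τ (k : ℤ)) else 0) * f k)]
    refine Finset.sum_congr rfl fun k _ => ?_
    simp only [Fin.val_castSucc, Fin.val_succ, Nat.cast_add, Nat.cast_one, add_sub_cancel_right]
    split_ifs <;> ring
  · simp only [Fin.val_last]
    rcases hK.lt_or_eq with h | rfl
    · rw [if_neg h.not_ge, if_neg fun h' => h.not_ge h'.1, zero_mul]
    · rw [if_pos le_rfl, if_pos ⟨le_rfl, hlast⟩, sub_self, zero_div, sub_zero, one_mul]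

/-- Error of an approximate product `p` of `h` and `u` when the factor `h`, bounded by `1`, is
itself only known approximately as `h'`. -/
theorem abs_mul_sub_le_of_approx {T q γ t h h' u p : ℝ} (hT : 0 < T) (hq : 2 < q)
    (hγ : γ ∈ Set.Ioc (0 : ℝ) 1) (ht : t ∈ Set.Icc 0 T) (hh : |h| ≤ 1)
    (hh' : |h - h'| ≤ γ * max 1 (|t| ^ q))
    (hp : |h' * u - p| ≤ γ * max 1 (max (|h'| ^ q) (|u| ^ q))) :
    |h * u - p| ≤ 2 * γ * (1 + (T + 1) ^ q) ^ q * (1 + |u| ^ q) := by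
  have hq1 : 1 ≤ q := by linarith
  set D := (T + 1) ^ q with hD
  have hD1 : 1 ≤ D := Real.one_le_rpow (by linarith) (by linarith)
  have htD : max 1 (|t| ^ q) ≤ D := by
    refine max_le hD1 (Real.rpow_le_rpow (abs_nonneg _) ?_ (by linarith))
    rw [abs_of_nonneg ht.1]
    linarith [ht.2]
  set C := (1 + D) ^ q with hC
  have hDC : 1 + D ≤ C := Real.self_le_rpow_of_one_le (by linarith) hq1
  have hh'D : |h'| ≤ 1 + D := by
    have h1 : |h'| ≤ |h| + |h - h'| := by
      calc |h'| = |h - (h - h')| := by ring_nf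
        _ ≤ _ := abs_sub _ _
    have h2 : γ * max 1 (|t| ^ q) ≤ 1 * D :=
      mul_le_mul hγ.2 htD (zero_le_one.trans (le_max_left _ _)) zero_le_one
    linarith
  have hh'C : |h'| ^ q ≤ C := Real.rpow_le_rpow (abs_nonneg _) hh'D (by linarith)
  have hu0 : 0 ≤ |u| ^ q := Real.rpow_nonneg (abs_nonneg _) _
  have hu : |u| ≤ 1 + |u| ^ q := by
    rcases le_total |u| 1 with h1 | h1
    · linarith
    · linarith [Real.self_le_rpow_of_one_le h1 hq1]
  have hC1 : 1 ≤ C := by linarith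
  have hCu : C ≤ C * (1 + |u| ^ q) := le_mul_of_one_le_right (by linarith) (by linarith)
  have huC : 1 + |u| ^ q ≤ C * (1 + |u| ^ q) := le_mul_of_one_le_left (by linarith) hC1
  have hmax : max 1 (max (|h'| ^ q) (|u| ^ q)) ≤ C * (1 + |u| ^ q) :=
    max_le (by linarith) (max_le (by linarith) (by linarith))
  have hfirst : |(h - h') * u| ≤ γ * (C * (1 + |u| ^ q)) := by
    rw [abs_mul, ← mul_assoc]
    refine mul_le_mul (hh'.trans ?_) hu (abs_nonneg _) (mul_nonneg hγ.1.le (by linarith))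
    exact mul_le_mul_of_nonneg_left (by linarith) hγ.1.le
  have hsecond := hp.trans (mul_le_mul_of_nonneg_left hmax hγ.1.le)
  calc |h * u - p| = |(h - h') * u + (h' * u - p)| := by ring_nf
    _ ≤ |(h - h') * u| + |h' * u - p| := abs_add_le _ _
    _ ≤ γ * (C * (1 + |u| ^ q)) + γ * (C * (1 + |u| ^ q)) := add_le_add hfirst hsecond
    _ = 2 * γ * C * (1 + |u| ^ q) := by ring

/-! ### Networks representing multilevel Picard approximations -/

/-- The recursion of the multilevel Picard approximations `U n θ t x` of a semilinear equation with
nonlinearity `f` and terminal value `g`, driven by the random times `𝒰` and the noise `W`. The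
indicator of `1 ≤ i` removes the correction term at `i = 0`, so the truncated subtraction `i - 1`
never matters. -/
def IsMLP {d : ℕ} (M : ℕ) (T : ℝ) (f : (Fin 1 → ℝ) → ℝ) (g : (Fin d → ℝ) → ℝ)
    (𝒰 : MLPIndex → ℝ → ℝ) (W : MLPIndex → ℝ → Fin d → ℝ)
    (U : ℕ → MLPIndex → ℝ → (Fin d → ℝ) → ℝ) : Prop :=
  (∀ θ, ∀ t ∈ Set.Icc 0 T, ∀ x, U 0 θ t x = 0) ∧
  ∀ θ, ∀ n : ℕ, 1 ≤ n → ∀ t ∈ Set.Icc 0 T, ∀ x,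
    U n θ t x =
      1 / (M : ℝ) ^ n *
          (∑ k ∈ Finset.Icc 1 (M ^ n), g (x + W (θ.ext 0 (-(k : ℤ))) (T - t)))
        + ∑ i ∈ Finset.range n, (T - t) / (M : ℝ) ^ (n - i) *
            ∑ k ∈ Finset.Icc 1 (M ^ (n - i)),
              (f ![U i (θ.ext i k) (𝒰 (θ.ext i k) t)
                    (x + W (θ.ext i k) (𝒰 (θ.ext i k) t - t))]
                - (if 1 ≤ i then 1 else 0) * f
                  ![U (max (i - 1) 0) (θ.ext (-(i : ℤ)) k) (𝒰 (θ.ext i k) t)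
                    (x + W (θ.ext i k) (𝒰 (θ.ext i k) t - t))])

/-- The recursion of the networks `UU n θ t` that mirrors, within the network calculus, the
recursion of the multilevel Picard approximations at the fixed time `t`. -/
def IsMLPNetwork {d : ℕ} (M : ℕ) (T : ℝ) (J F : ANN 1 1) (G : ANN d 1)
    (𝒰 : MLPIndex → ℝ → ℝ) (W : MLPIndex → ℝ → Fin d → ℝ)
    (UU : ℕ → MLPIndex → ℝ → ANN d 1) : Prop :=
  (∀ θ, ∀ t ∈ Set.Icc 0 T, UU 0 θ t = ANN.affine 0 0) ∧
  ∀ θ, ∀ n : ℕ, 1 ≤ n → ∀ t ∈ Set.Icc 0 T,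
    UU n θ t = ANN.boxSum J
      ![ANN.sameSumFromTo 1 (M ^ n) fun k =>
          ANN.scalarMul (1 / (M : ℝ) ^ n)
            (G.comp (ANN.affine 1 (W (θ.ext 0 (-(k : ℤ))) (T - t)))),
        ANN.boxSumFromTo J 0 (n - 1) fun i =>
          ANN.scalarMul ((T - t) / (M : ℝ) ^ (n - i))
            (ANN.boxSumFromTo J 1 (M ^ (n - i)) fun k =>
              (F.comp (UU i (θ.ext i k) (𝒰 (θ.ext i k) t))).comp
                (ANN.affine 1 (W (θ.ext i k) (𝒰 (θ.ext i k) t - t)))),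
        ANN.boxSumFromTo J 0 (n - 1) fun i =>
          ANN.scalarMul ((t - T) * (if 1 ≤ i then 1 else 0) / (M : ℝ) ^ (n - i))
            (ANN.boxSumFromTo J 1 (M ^ (n - i)) fun k =>
              (F.comp (UU (max (i - 1) 0) (θ.ext (-(i : ℤ)) k) (𝒰 (θ.ext i k) t))).comp
                (ANN.affine 1 (W (θ.ext i k) (𝒰 (θ.ext i k) t - t))))]

theorem forall_vec_three {α : Type*} {p : α → Prop} {x y z : α} (hx : p x) (hy : p y)
    (hz : p z) : ∀ k : Fin 3, p (![x, y, z] k) := by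
  simp [Fin.forall_fin_succ, hx, hy, hz]

theorem forall_vec_three₂ {α β : Type*} {p : α → β → Prop} {x y z : α} {x' y' z' : β}
    (hx : p x x') (hy : p y y') (hz : p z z') :
    ∀ k : Fin 3, p (![x, y, z] k) (![x', y', z'] k) := by
  simp [Fin.forall_fin_succ, hx, hy, hz]

namespace ANN

theorem length_sameSumFromTo {n m u v : ℕ} {Φ : ℕ → ANN n m} {L : ℕ}
    (hΦ : ∀ k, (Φ k).length = L) : (sameSumFromTo u v Φ).length = L :=
  length_sameSum fun _ => hΦ _

theorem realize_eq_vec_realizeScalar (a : ℝ → ℝ) {n : ℕ} (Φ : ANN n 1) (x : Fin n → ℝ) :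
    Φ.realize a x = ![Φ.realizeScalar a x] := by
  funext i
  rw [Subsingleton.elim i 0]
  rfl

theorem length_comp_affine {n l m : ℕ} (Φ : ANN l m) (W : Matrix (Fin l) (Fin n) ℝ)
    (B : Fin l → ℝ) : (Φ.comp (affine W B)).length = Φ.length :=
  rfl

theorem length_comp {n l m : ℕ} (Φ : ANN l m) (Ψ : ANN n l) :
    (Φ.comp Ψ).length = Φ.hidden + Ψ.length :=
  rfl

end ANN

namespace IsMLPNetwork

variable {d M : ℕ} {T : ℝ} {J F : ANN 1 1} {G : ANN d 1} {𝒰 : MLPIndex → ℝ → ℝ}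
  {W : MLPIndex → ℝ → Fin d → ℝ} {UU : ℕ → MLPIndex → ℝ → ANN d 1}

theorem realizeScalar_eq {a : ℝ → ℝ} {U : ℕ → MLPIndex → ℝ → (Fin d → ℝ) → ℝ}
    (hUU : IsMLPNetwork M T J F G 𝒰 W UU)
    (hU : IsMLP M T (F.realizeScalar a) (G.realizeScalar a) 𝒰 W U)
    (hM : 1 ≤ M) (hJ : J.hidden = 1) (hid : ∀ x, J.realize a x = x)
    (h𝒰 : ∀ θ, ∀ t ∈ Set.Icc 0 T, 𝒰 θ t ∈ Set.Icc 0 T) (n : ℕ) :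
    ∀ θ, ∀ t ∈ Set.Icc 0 T, ∀ x, (UU n θ t).realizeScalar a x = U n θ t x := by
  induction n using Nat.strong_induction_on with
  | _ n ih =>
  intro θ t ht x
  rcases Nat.eq_zero_or_pos n with rfl | hn
  · rw [hUU.1 θ t ht, hU.1 θ t ht, ANN.realizeScalar, ANN.realize_affine]
    simp
  have hpow (k : ℕ) : 1 ≤ M ^ k := Nat.one_le_pow _ _ hM
  have hrange : Finset.Icc 0 (n - 1) = Finset.range n := by
    ext i
    simp only [Finset.mem_Icc, Finset.mem_range]
    omega
  rw [hUU.2 θ n hn t ht, hU.2 θ n hn t ht, ANN.realizeScalar, ANN.realize_boxSum _ hJ hid,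
    Fin.sum_univ_three]
  simp only [Matrix.cons_val]
  rw [ANN.realize_sameSumFromTo a (hpow n) (L := G.length) fun k => by
      rw [ANN.length_scalarMul, ANN.length_comp_affine],
    ANN.realize_boxSumFromTo hJ hid (Nat.zero_le _),
    ANN.realize_boxSumFromTo hJ hid (Nat.zero_le _), hrange]
  simp only [ANN.realize_scalarMul, ANN.realize_boxSumFromTo hJ hid (hpow _),
    ANN.realize_comp, ANN.realize_affine, Matrix.one_mulVec, Pi.add_apply, Finset.sum_apply, Pi.smul_apply,
    smul_eq_mul]
  rw [add_assoc, ← Finset.sum_add_distrib]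
  refine congrArg₂ _ (Finset.mul_sum _ _ _).symm (Finset.sum_congr rfl fun i hi => ?_)
  have hi := Finset.mem_range.1 hi
  rw [Finset.sum_sub_distrib, ← Finset.mul_sum]
  have hvec (j : ℕ) (hj : j < n) (θ θ' : MLPIndex) (y : Fin d → ℝ) :
      (UU j θ (𝒰 θ' t)).realize a y = ![U j θ (𝒰 θ' t) y] := by
    rw [ANN.realize_eq_vec_realizeScalar, ih j hj θ _ (h𝒰 θ' t ht)]
  simp only [hvec i hi, hvec (max (i - 1) 0) (by omega), ANN.realizeScalar]
  ring

/-- Level `n` composes `F` with networks of level below `n`, and composition with `F` adds its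
number of hidden layers. -/
theorem length_le (hUU : IsMLPNetwork M T J F G 𝒰 W UU) (hM : 1 ≤ M) (hJ : J.hidden = 1)
    (h𝒰 : ∀ θ, ∀ t ∈ Set.Icc 0 T, 𝒰 θ t ∈ Set.Icc 0 T) (n : ℕ) :
    ∀ θ, ∀ t ∈ Set.Icc 0 T, (UU n θ t).length ≤ G.length + n * F.hidden := by
  induction n using Nat.strong_induction_on with
  | _ n ih =>
  intro θ t ht
  rcases Nat.eq_zero_or_pos n with rfl | hn
  · rw [hUU.1 θ t ht]
    exact G.length_pos.trans_le (Nat.le_add_right _ _)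
  have hpow (k : ℕ) : 1 ≤ M ^ k := Nat.one_le_pow _ _ hM
  have step {i : ℕ} (hi : i < n) (θ θ' : MLPIndex) (w : Fin d → ℝ) :
      ((F.comp (UU i θ (𝒰 θ' t))).comp (ANN.affine (1 : Matrix (Fin d) (Fin d) ℝ) w)).length ≤
        G.length + n * F.hidden := by
    rw [ANN.length_comp_affine, ANN.length_comp]
    have h1 := ih i hi θ _ (h𝒰 θ' t ht)
    have h2 : (i + 1) * F.hidden ≤ n * F.hidden := Nat.mul_le_mul_right _ hi
    rw [Nat.succ_mul] at h2
    omega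
  rw [hUU.2 θ n hn t ht]
  refine ANN.length_boxSum_le _ hJ
    (forall_vec_three (p := fun Φ : ANN d 1 => Φ.length ≤ _) ?_ ?_ ?_)
  · exact (ANN.length_sameSumFromTo fun k => by
      rw [ANN.length_scalarMul, ANN.length_comp_affine]).trans_le (Nat.le_add_right _ _)
  · refine ANN.length_boxSumFromTo_le hJ (Nat.zero_le _) fun i hi => ?_
    have hi := Finset.mem_Icc.1 hi
    rw [ANN.length_scalarMul]
    exact ANN.length_boxSumFromTo_le hJ (hpow _) fun k _ => step (by omega) _ _ _
  · refine ANN.length_boxSumFromTo_le hJ (Nat.zero_le _) fun i hi => ?_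
    have hi := Finset.mem_Icc.1 hi
    rw [ANN.length_scalarMul]
    exact ANN.length_boxSumFromTo_le hJ (hpow _) fun k _ => step (by omega) _ _ _

/-- The growth factor `3` of the hidden widths: the three groups of summands in the recursion
contribute `1`, the sum of the `3 ^ i`, and the sum of the shifted powers `3 ^ (i - 1)`.
The term `i = 0` of the last sum is `1`: the networks with coefficient `0` still occupy width. -/
theorem _root_.one_add_sum_three_pow_le (n : ℕ) :
    1 + ∑ i ∈ Finset.range (n + 1), 3 ^ i + ∑ i ∈ Finset.range (n + 1), 3 ^ (i - 1) ≤
      3 ^ (n + 1) := by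
  induction n with
  | zero => simp
  | succ n ih =>
    rw [Finset.sum_range_succ, Finset.sum_range_succ (fun i => 3 ^ (i - 1)), Nat.add_sub_cancel]
    have h1 : 3 ^ (n + 1) = 3 ^ n * 3 := pow_succ 3 n
    have h2 : 3 ^ (n + 1 + 1) = 3 ^ (n + 1) * 3 := pow_succ 3 (n + 1)
    omega

theorem hiddenLE (hUU : IsMLPNetwork M T J F G 𝒰 W UU) (hM : 1 ≤ M) (hJ : J.hidden = 1)
    (h𝒰 : ∀ θ, ∀ t ∈ Set.Icc 0 T, 𝒰 θ t ∈ Set.Icc 0 T) {c : ℕ} (hJc : J.HiddenLE c)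
    (hF : F.HiddenLE c) (hG : G.HiddenLE c) (n : ℕ) :
    ∀ θ, ∀ t ∈ Set.Icc 0 T, (UU n θ t).HiddenLE (c * (3 * M) ^ n) := by
  induction n using Nat.strong_induction_on with
  | _ n ih =>
  intro θ t ht
  rcases Nat.eq_zero_or_pos n with rfl | hn
  · rw [hUU.1 θ t ht]
    exact ANN.hiddenLE_affine _ _
  have hpow (k : ℕ) : 1 ≤ M ^ k := Nat.one_le_pow _ _ hM
  have hc (i : ℕ) : c ≤ c * (3 * M) ^ i :=
    Nat.le_mul_of_pos_right _ (Nat.pow_pos (by omega))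
  have step {i : ℕ} (hi : i < n) (θ θ' : MLPIndex) (w : Fin d → ℝ) :
      ((F.comp (UU i θ (𝒰 θ' t))).comp (ANN.affine (1 : Matrix (Fin d) (Fin d) ℝ) w)).HiddenLE (c * (3 * M) ^ i) :=
    ((hF.mono (hc i)).comp (ih i hi θ _ (h𝒰 θ' t ht))).comp (ANN.hiddenLE_affine _ _)
  have hsum {i : ℕ} (e : ℕ) : c ≤ ∑ _k ∈ Finset.Icc 1 (M ^ i), c * (3 * M) ^ e := by
    rw [Finset.sum_const, Nat.card_Icc, smul_eq_mul, Nat.add_sub_cancel]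
    exact (hc e).trans (Nat.le_mul_of_pos_left _ (hpow i))
  have hsum' (e : ℕ → ℕ) : c ≤ ∑ i ∈ Finset.Icc 0 (n - 1),
      ∑ _k ∈ Finset.Icc 1 (M ^ (n - i)), c * (3 * M) ^ e i :=
    (hsum (i := n - 0) (e 0)).trans (Finset.single_le_sum
      (f := fun i => ∑ _k ∈ Finset.Icc 1 (M ^ (n - i)), c * (3 * M) ^ e i)
      (fun _ _ => Nat.zero_le _) (Finset.mem_Icc.2 ⟨le_rfl, Nat.zero_le _⟩))
  rw [hUU.2 θ n hn t ht]
  refine ANN.HiddenLE.mono (ANN.HiddenLE.boxSum hJ hJc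
    (b := ![∑ _k ∈ Finset.Icc 1 (M ^ n), c * (3 * M) ^ 0,
      ∑ i ∈ Finset.Icc 0 (n - 1), ∑ _k ∈ Finset.Icc 1 (M ^ (n - i)), c * (3 * M) ^ i,
      ∑ i ∈ Finset.Icc 0 (n - 1), ∑ _k ∈ Finset.Icc 1 (M ^ (n - i)), c * (3 * M) ^ (i - 1)])
    (forall_vec_three (hsum 0) (hsum' fun i => i) (hsum' fun i => i - 1))
    (forall_vec_three₂ (p := fun (Φ : ANN d 1) b => Φ.HiddenLE b) ?_ ?_ ?_)) ?_
  · refine ANN.HiddenLE.sameSumFromTo (hpow n) (L := G.length) (fun k => ?_) fun k _ => ?_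
    · rw [ANN.length_scalarMul, ANN.length_comp_affine]
    · exact ((hG.mono (hc 0)).comp (ANN.hiddenLE_affine _ _)).scalarMul _
  · refine ANN.HiddenLE.boxSumFromTo hJ (Nat.zero_le _) hJc (fun i _ => hsum i) fun i hi => ?_
    have hi := Finset.mem_Icc.1 hi
    exact (ANN.HiddenLE.boxSumFromTo hJ (hpow _) hJc (fun _ _ => hc i)
      fun k _ => step (by omega) _ _ _).scalarMul _
  · refine ANN.HiddenLE.boxSumFromTo hJ (Nat.zero_le _) hJc (fun i _ => hsum (i - 1))
      fun i hi => ?_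
    have hi := Finset.mem_Icc.1 hi
    exact (ANN.HiddenLE.boxSumFromTo hJ (hpow _) hJc (fun _ _ => hc (i - 1))
      fun k _ => (step (i := max (i - 1) 0) (by omega) _ _ _).mono
        (by rw [Nat.max_zero])).scalarMul _
  · -- each of the three sums is at most `c * M ^ n` times a geometric sum with ratio `3`
    obtain ⟨n, rfl⟩ : ∃ k, n = k + 1 := ⟨n - 1, by omega⟩
    have hterm {i e : ℕ} (hi : i ≤ n) (he : e ≤ i) :
        M ^ (n + 1 - i) * (c * (3 * M) ^ e) ≤ c * M ^ (n + 1) * 3 ^ e := by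
      calc M ^ (n + 1 - i) * (c * (3 * M) ^ e)
          = c * M ^ (n + 1 - i + e) * 3 ^ e := by rw [mul_pow, pow_add]; ring
        _ ≤ c * M ^ (n + 1) * 3 ^ e :=
          Nat.mul_le_mul_right _ (Nat.mul_le_mul_left _ (Nat.pow_le_pow_right hM (by omega)))
    rw [Fin.sum_univ_three]
    simp only [Matrix.cons_val, Finset.sum_const, Nat.card_Icc, Nat.add_sub_cancel, smul_eq_mul,
      ← Nat.range_succ_eq_Icc_zero]
    calc M ^ (n + 1) * (c * (3 * M) ^ 0)
          + ∑ i ∈ Finset.range (n + 1), M ^ (n + 1 - i) * (c * (3 * M) ^ i)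
          + ∑ i ∈ Finset.range (n + 1), M ^ (n + 1 - i) * (c * (3 * M) ^ (i - 1))
        ≤ c * M ^ (n + 1) * 1 + ∑ i ∈ Finset.range (n + 1), c * M ^ (n + 1) * 3 ^ i
          + ∑ i ∈ Finset.range (n + 1), c * M ^ (n + 1) * 3 ^ (i - 1) := by
          refine add_le_add (add_le_add (hterm (Nat.zero_le n) le_rfl) ?_) ?_ <;>
            refine Finset.sum_le_sum fun i hi => ?_ <;>
            have hi := Finset.mem_range.1 hi
          · exact hterm (by omega) le_rfl
          · exact hterm (by omega) (Nat.sub_le _ _)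
      _ = c * M ^ (n + 1) * (1 + ∑ i ∈ Finset.range (n + 1), 3 ^ i
          + ∑ i ∈ Finset.range (n + 1), 3 ^ (i - 1)) := by
          rw [← Finset.mul_sum, ← Finset.mul_sum]; ring
      _ ≤ c * M ^ (n + 1) * 3 ^ (n + 1) :=
          Nat.mul_le_mul_left _ (one_add_sum_three_pow_le n)
      _ = c * (3 * M) ^ (n + 1) := by rw [mul_pow]; ring

end IsMLPNetwork

/-! ### Networks for the interpolation in time -/

theorem append_eq_vec_two (u v : Fin 1 → ℝ) : Fin.append u v = ![u 0, v 0] := by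
  funext i
  fin_cases i <;> rfl

theorem ANN.params_le_of_hiddenLE {n m b : ℕ} {Φ : ANN n m} (hΦ : Φ.HiddenLE b) (hn : n ≤ b)
    (hm : m ≤ b) : Φ.params ≤ Φ.length * (b * (b + 1)) :=
  ANNLayers.params_le_of_hiddenLE hΦ hn hm

theorem ANN.hidden_and_hiddenLE_of_dims {J : ANN 1 1} {w : ℕ} (hw : 1 ≤ w)
    (hJ : J.dims = [1, w, 1]) : J.hidden = 1 ∧ J.HiddenLE w := by
  constructor
  · have h := J.layers.length_dims
    rw [show J.layers.dims = [1, w, 1] from hJ] at h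
    exact (Nat.succ_injective (Nat.succ_injective h)).symm
  · refine J.layers.hiddenLE_of_dims_le fun k hk => ?_
    rw [show J.layers.dims = [1, w, 1] from hJ] at hk
    simp only [List.mem_cons, List.not_mem_nil, or_false] at hk
    omega

/-- The network `Γ • P₂(H k, V k)` summed over `k ≤ K` realizes the sum of the approximate
products of `H k` and `V k`. -/
theorem realizeScalar_boxSum_products {a : ℝ → ℝ} {d K : ℕ} {J : ANN 1 1} (hJ : J.hidden = 1)
    (hid : ∀ x, J.realize a x = x) (Γ : ANN 2 1) (H : ℕ → ANN 1 1) (V : ℕ → ANN d 1) (t : ℝ)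
    (x : Fin d → ℝ) :
    (ANN.boxSumFromTo J 0 K fun k => ANN.comp Γ (ANN.genParTwo J (H k) (V k))).realizeScalar a
        (Fin.append ![t] x) =
      ∑ k ∈ Finset.range (K + 1),
        Γ.realizeScalar a ![(H k).realizeScalar a ![t], (V k).realizeScalar a x] := by
  rw [ANN.realizeScalar, ANN.realize_boxSumFromTo hJ hid (Nat.zero_le _), Finset.sum_apply,
    ← Nat.range_succ_eq_Icc_zero]
  refine Finset.sum_congr rfl fun k _ => ?_
  rw [ANN.realize_comp, ANN.realize_genParTwo _ _ hJ hid, append_eq_vec_two]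
  rfl

/-- The crude bound `P ≤ L * W * (W + 1)` for a network of length `L` all of whose layer dimensions
are at most `W`, applied with `W = (K + 1) * g * (h * w) * X`, where `Γ` has `g`
parameters, each `H k` has at most `h` parameters, `w` bounds the hidden width of `J`, and `X` the
hidden widths of all `V k`. -/
theorem params_boxSum_products_le {d K w X N g h : ℕ} {J : ANN 1 1} (hJ : J.hidden = 1)
    (hJw : J.HiddenLE w) (hw : 1 ≤ w) (hwX : w ≤ X) (hdX : d ≤ X) {Γ : ANN 2 1}
    {H : ℕ → ANN 1 1} {V : ℕ → ANN d 1} (hg : Γ.params = g)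
    (hh : ∀ k ≤ K, (H k).params ≤ h) (hV : ∀ k ≤ K, (V k).HiddenLE X)
    (hVN : ∀ k ≤ K, (V k).length ≤ N) :
    (ANN.boxSumFromTo J 0 K fun k => ANN.comp Γ (ANN.genParTwo J (H k) (V k))).params ≤
      (g + h + N) * (2 * ((K + 1) * (g * (h * w) * X)) ^ 2) := by
  have hX : 1 ≤ X := hw.trans hwX
  have hg3 : 3 ≤ g := hg ▸ Γ.layers.input_lt_params Nat.one_pos
  have hh2 : 2 ≤ h := ((H 0).layers.input_lt_params Nat.one_pos).trans_le (hh 0 (Nat.zero_le _))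
  have hhw : 2 ≤ h * w := hh2.trans (Nat.le_mul_of_pos_right _ hw)
  have hwhw : w ≤ h * w := Nat.le_mul_of_pos_left _ (by omega)
  have hhhw : h ≤ h * w := Nat.le_mul_of_pos_right _ hw
  set y := h * w
  have hyX : y + X ≤ 2 * (y * X) := by
    have h1 : y ≤ y * X := Nat.le_mul_of_pos_right _ hX
    have h2 : X ≤ y * X := Nat.le_mul_of_pos_left _ (by omega)
    omega
  have hyXg : 3 * (y * X) ≤ g * y * X := by
    rw [mul_assoc g]
    exact Nat.mul_le_mul_right _ hg3
  have hgg : g ≤ g * y * X := by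
    rw [mul_assoc g]
    exact Nat.le_mul_of_pos_right _ (Nat.mul_pos (by omega) hX)
  set b := g * y * X
  have hbW : b ≤ (K + 1) * b := Nat.le_mul_of_pos_left _ (Nat.succ_pos K)
  have hXy : X ≤ y * X := Nat.le_mul_of_pos_left _ (by omega)
  have hHid : (ANN.boxSumFromTo J 0 K fun k =>
      ANN.comp Γ (ANN.genParTwo J (H k) (V k))).HiddenLE ((K + 1) * b) := by
    have hconst : ∑ _k ∈ Finset.Icc 0 K, b = (K + 1) * b := by simp
    rw [← hconst]
    refine ANN.HiddenLE.boxSumFromTo hJ (Nat.zero_le _) hJw (fun _ _ => by omega) fun k hk => ?_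
    have hk := (Finset.mem_Icc.1 hk).2
    refine ANN.HiddenLE.comp (ANN.HiddenLE.mono Γ.layers.hiddenLE_params ?_) ?_
    · change Γ.params ≤ b
      omega
    · refine (ANN.HiddenLE.genParTwo hJ (hJw.mono hwhw) (hJw.mono hwX)
        (ANN.HiddenLE.mono (H k).layers.hiddenLE_params ((hh k hk).trans hhhw))
        (hV k hk)).mono (by omega)
  have hlen : (ANN.boxSumFromTo J 0 K fun k =>
      ANN.comp Γ (ANN.genParTwo J (H k) (V k))).length ≤ g + h + N := by
    refine ANN.length_boxSumFromTo_le hJ (Nat.zero_le _) fun k hk => ?_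
    have hk := (Finset.mem_Icc.1 hk).2
    have h1 : Γ.hidden + 1 ≤ Γ.params := Γ.layers.succ_le_params Nat.one_pos
    have h2 : (H k).length ≤ (H k).params := (H k).layers.succ_le_params Nat.one_pos
    have h3 := hh k hk
    have h4 := hVN k hk
    rw [ANN.length_comp, ANN.length_genParTwo _ _ hJ]
    omega
  refine (ANN.params_le_of_hiddenLE hHid (by omega) (by omega)).trans
    (Nat.mul_le_mul hlen ?_)
  generalize (K + 1) * b = B at hbW
  calc B * (B + 1) ≤ B * (2 * B) := Nat.mul_le_mul_left _ (by omega)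
    _ = 2 * B ^ 2 := by ring

theorem length_mul_sq_width_le {g h w n S X k N : ℕ} (hg : 1 ≤ g) (hh : 1 ≤ h) (hn : 1 ≤ n) (hS : 1 ≤ S)
    (hN : N ≤ n * S) :
    (g + h + N) * (2 * (k * (g * (h * w) * X)) ^ 2) ≤
      16 * S * n * X ^ 2 * g ^ 3 * h ^ 3 * k ^ 2 * w ^ 2 := by
  have h1 : g ≤ g * (h * (n * S)) :=
    Nat.le_mul_of_pos_right _ (Nat.mul_pos hh (Nat.mul_pos hn hS))
  have h2 : h ≤ g * (h * (n * S)) :=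
    (Nat.le_mul_of_pos_right _ (Nat.mul_pos hn hS)).trans (Nat.le_mul_of_pos_left _ hg)
  have h3 : N ≤ g * (h * (n * S)) := hN.trans
    ((Nat.le_mul_of_pos_left _ hh).trans (Nat.le_mul_of_pos_left _ hg))
  calc (g + h + N) * (2 * (k * (g * (h * w) * X)) ^ 2)
      ≤ (8 * (g * (h * (n * S)))) * (2 * (k * (g * (h * w) * X)) ^ 2) :=
        Nat.mul_le_mul_right _ (by omega)
    _ = 16 * S * n * X ^ 2 * g ^ 3 * h ^ 3 * k ^ 2 * w ^ 2 := by ring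

theorem corollary4p11
    (K d 𝔡 M : ℕ) (hK : 1 ≤ K) (hd : 1 ≤ d) (h𝔡 : 1 ≤ 𝔡) (hM : 1 ≤ M)
    (T q : ℝ) (hT : 0 < T) (hq : 2 < q)
    -- the grid `τ (-1) < 0 = τ 0 < τ 1 < ... < τ K = T < τ (K + 1)`
    (τ : ℤ → ℝ) (hτ : ∀ k : ℤ, -1 ≤ k → k ≤ K → τ k < τ (k + 1))
    (hτ0 : τ 0 = 0) (hτK : τ K = T)
    (a : ℝ → ℝ) (ha : Continuous a)
    (J : ANN 1 1) (F : ANN 1 1) (G : ANN d 1)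
    (hJdims : J.dims = [1, 𝔡, 1]) (hJ : ∀ x : Fin 1 → ℝ, J.realize a x = x)
    -- approximations of the hat functions
    (H : ℕ → ℝ → ANN 1 1)
    (hH : ∀ k ≤ K, ∀ γ ∈ Set.Ioc (0 : ℝ) 1, ∀ t : ℝ,
      |linInterp ![τ ((k : ℤ) - 1), τ (k : ℤ), τ ((k : ℤ) + 1)] ![0, 1, 0] t
          - (H k γ).realizeScalar a ![t]|
        ≤ γ * max 1 (|t| ^ q))
    -- approximations of the product
    (Γ : ℝ → ANN 2 1)
    (hΓ : ∀ γ ∈ Set.Ioc (0 : ℝ) 1, ∀ v w : ℝ,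
      |v * w - (Γ γ).realizeScalar a ![v, w]| ≤ γ * max 1 (max (|v| ^ q) (|w| ^ q)))
    (𝒰 : MLPIndex → ℝ → ℝ)
    (h𝒰 : ∀ θ, ∀ t ∈ Set.Icc 0 T, 𝒰 θ t ∈ Set.Icc 0 T)
    (W : MLPIndex → ℝ → Fin d → ℝ)
    -- the MLP approximations
    (U : ℕ → MLPIndex → ℝ → (Fin d → ℝ) → ℝ)
    (hU0 : ∀ θ, ∀ t ∈ Set.Icc 0 T, ∀ x, U 0 θ t x = 0)
    (hU : ∀ θ, ∀ n : ℕ, 1 ≤ n → ∀ t ∈ Set.Icc 0 T, ∀ x,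
      U n θ t x =
        1 / (M : ℝ) ^ n *
            (∑ k ∈ Finset.Icc 1 (M ^ n), G.realizeScalar a (x + W (θ.ext 0 (-(k : ℤ))) (T - t)))
          + ∑ i ∈ Finset.range n, (T - t) / (M : ℝ) ^ (n - i) *
              ∑ k ∈ Finset.Icc 1 (M ^ (n - i)),
                (F.realizeScalar a
                    ![U i (θ.ext i k) (𝒰 (θ.ext i k) t)
                      (x + W (θ.ext i k) (𝒰 (θ.ext i k) t - t))]
                  - (if 1 ≤ i then 1 else 0) * F.realizeScalar a
                    ![U (max (i - 1) 0) (θ.ext (-(i : ℤ)) k) (𝒰 (θ.ext i k) t)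
                      (x + W (θ.ext i k) (𝒰 (θ.ext i k) t - t))]))
    -- the ANNs representing the MLP approximations at fixed times
    (UU : ℕ → MLPIndex → ℝ → ANN d 1)
    (hUU0 : ∀ θ, ∀ t ∈ Set.Icc 0 T, UU 0 θ t = ANN.affine 0 0)
    (hUU : ∀ θ, ∀ n : ℕ, 1 ≤ n → ∀ t ∈ Set.Icc 0 T,
      UU n θ t = ANN.boxSum J
        ![ANN.sameSumFromTo 1 (M ^ n) fun k =>
            ANN.scalarMul (1 / (M : ℝ) ^ n)
              (G.comp (ANN.affine 1 (W (θ.ext 0 (-(k : ℤ))) (T - t)))),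
          ANN.boxSumFromTo J 0 (n - 1) fun i =>
            ANN.scalarMul ((T - t) / (M : ℝ) ^ (n - i))
              (ANN.boxSumFromTo J 1 (M ^ (n - i)) fun k =>
                (F.comp (UU i (θ.ext i k) (𝒰 (θ.ext i k) t))).comp
                  (ANN.affine 1 (W (θ.ext i k) (𝒰 (θ.ext i k) t - t)))),
          ANN.boxSumFromTo J 0 (n - 1) fun i =>
            ANN.scalarMul ((t - T) * (if 1 ≤ i then 1 else 0) / (M : ℝ) ^ (n - i))
              (ANN.boxSumFromTo J 1 (M ^ (n - i)) fun k =>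
                (F.comp (UU (max (i - 1) 0) (θ.ext (-(i : ℤ)) k) (𝒰 (θ.ext i k) t))).comp
                  (ANN.affine 1 (W (θ.ext i k) (𝒰 (θ.ext i k) t - t))))])
    -- the ANNs approximating the linear interpolation
    (Φ : MLPIndex → ℝ → ℕ → ANN (1 + d) 1)
    (hΦ : ∀ θ, ∀ γ ∈ Set.Ioc (0 : ℝ) 1, ∀ n : ℕ, 1 ≤ n →
      Φ θ γ n = ANN.boxSumFromTo J 0 K fun k =>
        (Γ γ).comp (ANN.genParTwo J (H k γ) (UU n θ (τ (k : ℤ))))) :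
    (∀ θ, ∀ γ ∈ Set.Ioc (0 : ℝ) 1, ∀ n : ℕ, 1 ≤ n →
      Continuous ((Φ θ γ n).realize a) ∧
      ∀ (t : ℝ) (x : Fin d → ℝ),
        (Φ θ γ n).realizeScalar a (Fin.append ![t] x) =
          ∑ k ∈ Finset.range (K + 1),
            (Γ γ).realizeScalar a ![(H k γ).realizeScalar a ![t], U n θ (τ (k : ℤ)) x]) ∧
    (∀ θ, ∀ γ ∈ Set.Ioc (0 : ℝ) 1, ∀ n : ℕ, 1 ≤ n → ∀ t ∈ Set.Icc 0 T, ∀ x : Fin d → ℝ,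
      |linInterp (fun k : Fin (K + 1) => τ ((k : ℕ) : ℤ))
            (fun k : Fin (K + 1) => U n θ (τ ((k : ℕ) : ℤ)) x) t
          - (Φ θ γ n).realizeScalar a (Fin.append ![t] x)|
        ≤ 2 * γ * (1 + (T + 1) ^ q) ^ q *
            ∑ k ∈ Finset.range (K + 1), (1 + |U n θ (τ (k : ℤ)) x| ^ q)) ∧
    (∀ θ, ∀ γ ∈ Set.Ioc (0 : ℝ) 1, ∀ n : ℕ, 1 ≤ n →
      ((Φ θ γ n).params : ℝ) ≤
        16 * (max (𝔡 : ℝ) G.length + F.length)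
          * (max (𝔡 : ℝ) (max (F.maxDim : ℝ) G.maxDim)) ^ 2
          * ((n : ℝ) ^ (1 / 2 : ℝ) * (3 * (M : ℝ)) ^ n) ^ 2
          * ((Γ γ).params : ℝ) ^ 3
          * (((Finset.range (K + 1)).sup fun k => (H k γ).params : ℕ) : ℝ) ^ 3
          * ((K : ℝ) + 1) ^ 2 * (𝔡 : ℝ) ^ 2) := by

  obtain ⟨hJ1, hJw⟩ := ANN.hidden_and_hiddenLE_of_dims h𝔡 hJdims
  have hMLP : IsMLP M T (F.realizeScalar a) (G.realizeScalar a) 𝒰 W U := ⟨hU0, hU⟩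
  have hNet : IsMLPNetwork M T J F G 𝒰 W UU := ⟨hUU0, hUU⟩
  have hmono {k : ℕ} (hk : k ≤ K) : τ 0 ≤ τ k := by
    induction k with
    | zero => exact le_rfl
    | succ k ih =>
      refine (ih (by omega)).trans ?_
      rw [Nat.cast_succ]
      exact (hτ k (by omega) (by omega)).le
  have hmono' {j : ℕ} (hj : j ≤ K) : τ ((K - j : ℕ) : ℤ) ≤ τ K := by
    induction j with
    | zero => exact le_rfl
    | succ j ih =>
      have h := (hτ ((K - (j + 1) : ℕ) : ℤ) (by omega) (by omega)).le
      rw [show (((K - (j + 1) : ℕ) : ℤ) + 1) = ((K - j : ℕ) : ℤ) by omega] at h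
      exact h.trans (ih (by omega))
  have hgrid {k : ℕ} (hk : k ≤ K) : τ k ∈ Set.Icc 0 T := by
    have h1 := hmono hk
    have h2 := hmono' (j := K - k) (Nat.sub_le _ _)
    rw [Nat.sub_sub_self hk, hτK] at h2
    rw [hτ0] at h1
    exact ⟨h1, h2⟩
  have hreal : ∀ θ, ∀ γ ∈ Set.Ioc (0 : ℝ) 1, ∀ n : ℕ, 1 ≤ n → ∀ (t : ℝ) (x : Fin d → ℝ),
      (Φ θ γ n).realizeScalar a (Fin.append ![t] x) = ∑ k ∈ Finset.range (K + 1),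
        (Γ γ).realizeScalar a ![(H k γ).realizeScalar a ![t], U n θ (τ (k : ℤ)) x] := by
    intro θ γ hγ n hn t x
    rw [hΦ θ γ hγ n hn]
    refine (realizeScalar_boxSum_products hJ1 hJ _ _ _ t x).trans
      (Finset.sum_congr rfl fun k hk => ?_)
    rw [hNet.realizeScalar_eq hMLP hM hJ1 hJ h𝒰 n θ _
      (hgrid (Nat.lt_succ_iff.1 (Finset.mem_range.1 hk))) x]
  refine ⟨fun θ γ hγ n hn => ⟨ANNLayers.continuous_realize ha _, hreal θ γ hγ n hn⟩, ?_, ?_⟩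
  · intro θ γ hγ n hn t ht x
    rw [hreal θ γ hγ n hn, linInterp_eq_sum_hat K τ (hτ K (by omega) le_rfl)
      (fun k => U n θ (τ (k : ℤ)) x) (by rw [hτ0]; exact ht.1) (by rw [hτK]; exact ht.2),
      ← Finset.sum_sub_distrib, Finset.mul_sum]
    refine (Finset.abs_sum_le_sum_abs _ _).trans (Finset.sum_le_sum fun k hk => ?_)
    have hk := Nat.lt_succ_iff.1 (Finset.mem_range.1 hk)
    have hlt := hτ ((k : ℤ) - 1) (by omega) (by omega)
    rw [sub_add_cancel] at hlt
    exact abs_mul_sub_le_of_approx hT hq hγ ht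
      (abs_linInterp_hat_le hlt (hτ k (by omega) (by exact_mod_cast hk)) t)
      (hH k hk γ hγ t) (hΓ γ hγ _ _)
  · intro θ γ hγ n hn
    set c := max 𝔡 (max F.maxDim G.maxDim) with hc
    set h := (Finset.range (K + 1)).sup fun k => (H k γ).params with hh
    have hcX : c ≤ c * (3 * M) ^ n := Nat.le_mul_of_pos_right _ (Nat.pow_pos (by omega))
    have hFc : F.maxDim ≤ c := (le_max_left _ _).trans (le_max_right _ _)
    have hGc : G.maxDim ≤ c := (le_max_right _ _).trans (le_max_right _ _)
    have h𝔡c : 𝔡 ≤ c := le_max_left _ _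
    have hHh : ∀ k ≤ K, (H k γ).params ≤ h := fun k hk =>
      Finset.le_sup (f := fun k => (H k γ).params) (Finset.mem_range.2 (Nat.lt_succ_iff.2 hk))
    have hparams := params_boxSum_products_le (K := K) (X := c * (3 * M) ^ n)
      (N := G.length + n * F.hidden) (Γ := Γ γ) (H := fun k => H k γ)
      (V := fun k => UU n θ (τ (k : ℤ))) hJ1 hJw h𝔡 (h𝔡c.trans hcX)
      ((G.input_le_maxDim.trans hGc).trans hcX) rfl hHh
      (fun k hk => hNet.hiddenLE hM hJ1 h𝒰 (hJw.mono h𝔡c) (F.hiddenLE_maxDim.mono hFc)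
        (G.hiddenLE_maxDim.mono hGc) n θ _ (hgrid hk))
      fun k hk => hNet.length_le hM hJ1 h𝒰 n θ _ (hgrid hk)
    have hlen : G.length + n * F.hidden ≤ n * (max 𝔡 G.length + F.length) := by
      have h1 : G.length ≤ n * max 𝔡 G.length :=
        (le_max_right _ _).trans (Nat.le_mul_of_pos_left _ hn)
      have h2 : n * F.hidden ≤ n * F.length := Nat.mul_le_mul_left _ (Nat.le_succ _)
      rw [mul_add]
      omega
    have hbound := hparams.trans (length_mul_sq_width_le
      (Nat.one_le_iff_ne_zero.2 ((Γ γ).layers.input_lt_params Nat.one_pos).ne_bot)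
      (Nat.one_le_iff_ne_zero.2
        (((H 0 γ).layers.input_lt_params Nat.one_pos).trans_le (hHh 0 (Nat.zero_le _))).ne_bot)
      hn (h𝔡.trans ((le_max_left _ _).trans (Nat.le_add_right _ _))) hlen)
    have hcast : (c : ℝ) = max (𝔡 : ℝ) (max (F.maxDim : ℝ) G.maxDim) := by
      rw [hc]; push_cast; rfl
    -- the square cancels the exponent `1 / 2` of `n`, so the claim is the cast of `hbound`
    have hsqrt : ((n : ℝ) ^ (1 / 2 : ℝ)) ^ 2 = n := by
      rw [← Real.sqrt_eq_rpow, Real.sq_sqrt (Nat.cast_nonneg n)]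
    rw [← hcast, mul_pow ((n : ℝ) ^ (1 / 2 : ℝ)), hsqrt, hΦ θ γ hγ n hn]
    refine (Nat.cast_le (α := ℝ).2 hbound).trans (le_of_eq ?_)
    push_cast
    ring
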